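/- Let $E$ be a finite set of $n$ items, let each item have a state in a set $O$, and let the random realization $\Phi\in O^E$ have a known discrete distribution $p$. Let $f:2^E\times O^E\to\mathbb R_{\ge 0}$ be a utility function such that $\mathbb E[f(S,\Phi)]<\infty$ for all $S\subseteq E$. A (randomized) adaptive policy $\pi$ selects items one at a time, observing the state of an item once it is selected, and may base its decisions on its observations so far and on its own randomness, which is independent of $\Phi$. Let $E(\pi,\phi)$ be the (random) set of items that it selects under the realization $\phi$, and $f_{avg}(\pi)=\mathbb E[f(E(\pi,\Phi),\Phi)]$. For a partial realization $\psi$ (the states of a set $\mathrm{dom}(\psi)$ of items) with $\Pr[\Phi\sim\psi]>0$, where $\Phi\sim\psi$ means that $\Phi$ agrees with $\psi$ on $\mathrm{dom}(\psi)$, put $$\Delta(\pi\mid\psi)=\mathbb E[f(\mathrm{dom}(\psi)\cup E(\pi,\Phi),\Phi)-f(\mathrm{dom}(\psi),\Phi)\mid\Phi\sim\psi],$$ $$\Delta(e\mid\psi)=\mathbb E[f(\mathrm{dom}(\psi)\cup\{e\},\Phi)-f(\mathrm{dom}(\psi),\Phi)\mid\Phi\sim\psi].$$ The function $f$ is adaptive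 monotone if $\Delta(e\mid\psi)\ge 0$ for all such $\psi$ and all $e\in E$. It is fully adaptive submodular if $$\sup_{\pi\in\Omega(V,a)}\Delta(\pi\mid\psi)\ \ge\ \sup_{\pi\in\Omega(V,a)}\Delta(\pi\mid\psi')$$ for all such $\psi\subseteq\psi'$, all $V\subseteq E$ and all $1\le a\le|V|$, where $\Omega(V,a)$ is the set of policies that always select at most $a$ items, all of them from $V$. Let $B_1,\dots,B_b$ be pairwise disjoint sets with union $E$ and let $0\le d_i\le|B_i|$ be integers. A policy $\pi$ is feasible if always $|E(\pi,\phi)\cap B_i|\le d_i$ for all $i$ and all $\phi$. For $0<\varepsilon<1$, the Generalized Adaptive Stochastic Greedy policy $\pi^{gasg}$ processes the blocks $B_1,\dots,B_b$ in order. On block $B_i$ it performs $d_i$ rounds of adaptive stochastic greedy: in each round it draws a uniformly random subset $S\subseteq B_i$ of size $\min\{\lceil\frac{|B_i|}{d_i}\log\frac1\varepsilon\rceil,|B_i|\}$, asks a value oracle for $\Delta(e\mid\psi)$ for each $e\in S$, where $\psi$ is the current partial realization, and selects an $e\in S$ with the largest $\Delta(e\mid\psi)$, with ties broken arbitrarily.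 **Theorem.** If $f$ is fully adaptive submodular and adaptive monotone, then $\pi^{gasg}$ is feasible, and $$f_{avg}(\pi^{gasg})\ \ge\ \frac{1-1/e-\varepsilon}{4-2/e-2\varepsilon}\,f_{avg}(\pi^{opt})$$ for every feasible policy $\pi^{opt}$ (in particular for an optimal one). Moreover, $\pi^{gasg}$ uses $O(n\log\frac1\varepsilon)$ value oracle queries: for each $\varepsilon_0<1$ there is a constant $C$ that depends only on $\varepsilon_0$ such that, for all instances as above and all $0<\varepsilon\le\varepsilon_0$, the number of queries is at most $C\,n\log\frac1\varepsilon$ in the worst case over all random draws and observed states. -/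

import Mathlib

universe u v

noncomputable section

namespace AdaptiveSubmodular

/-- A partial realization: the observed states of some of the items (`none` = not observed). -/
abbrev PartialRealization (E : Type u) (O : Type v) := E → Option O

namespace PartialRealization

variable {E : Type u} {O : Type v}

/-- The set of observed items. -/
def dom [Fintype E] (ψ : PartialRealization E O) : Finset E :=
  Finset.univ.filter fun e => (ψ e).isSome = true

/-- The set of realizations `φ` that are consistent with `ψ`, i.e. `φ ∼ ψ`. -/
def consistent (ψ : PartialRealization E O) : Set (E → O) :=
  {φ | ∀ e o, ψ e = some o → φ e = o}

/-- `ψ` is a subrealization of `ψ'`. -/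
def IsSub (ψ ψ' : PartialRealization E O) : Prop :=
  ∀ e o, ψ e = some o → ψ' e = some o

end PartialRealization

/-- A (randomized) adaptive policy, as a decision tree. A policy may halt, draw a random subset of
the ground set from a distribution of its choice (its only source of randomness; a distribution on
items is the case of singletons) and go on depending on the outcome, or select an item, observe
the state of this item, and go on depending on the observed state. -/
inductive Policy (E : Type u) (O : Type v) : Type (max u v)
  | halt : Policy E O
  | sample (μ : PMF (Finset E)) (next : Finset E → Policy E O) : Policy E O
  | select (e : E) (next : O → Policy E O) : Policy E O

/-- The law of the set `E(π, φ)` of the items selected by `π` under the realization `φ`. -/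
def Policy.selected {E : Type u} {O : Type v} [DecidableEq E] (φ : E → O) :
    Policy E O → PMF (Finset E)
  | .halt => PMF.pure ∅
  | .sample μ next => μ.bind fun S => (next S).selected φ
  | .select e next => ((next (φ e)).selected φ).map (insert e)

section Utility

variable {E : Type u} {O : Type v} [Fintype E] [DecidableEq E]

/-- The expectation of `g` over the set of items selected by `π` under the realization `φ`. -/
def Policy.expect (π : Policy E O) (φ : E → O) (g : Finset E → ℝ) : ℝ :=
  ∑ S : Finset E, (π.selected φ S).toReal * g S

/-- The expected utility `f_avg(π)`, over the random realization and the randomness of `π`. -/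
def favg (p : PMF (E → O)) (f : Finset E → (E → O) → ℝ) (π : Policy E O) : ℝ :=
  ∑' φ, (p φ).toReal * π.expect φ fun S => f S φ

/-- `Pr[Φ ∼ ψ]`. -/
def prob (p : PMF (E → O)) (ψ : PartialRealization E O) : ℝ :=
  ∑' φ, ψ.consistent.indicator (fun φ => (p φ).toReal) φ

/-- `𝔼[g(Φ) ∣ Φ ∼ ψ]`. -/
def condExpect (p : PMF (E → O)) (ψ : PartialRealization E O) (g : (E → O) → ℝ) : ℝ :=
  (∑' φ, ψ.consistent.indicator (fun φ => (p φ).toReal * g φ) φ) / prob p ψ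

/-- The conditional expected marginal utility `Δ(S ∣ ψ)` of a set of items. -/
def marginal (p : PMF (E → O)) (f : Finset E → (E → O) → ℝ) (S : Finset E)
    (ψ : PartialRealization E O) : ℝ :=
  condExpect p ψ fun φ => f (ψ.dom ∪ S) φ - f ψ.dom φ

/-- The conditional expected marginal utility `Δ(π ∣ ψ)` of a policy. -/
def policyMarginal (p : PMF (E → O)) (f : Finset E → (E → O) → ℝ) (π : Policy E O)
    (ψ : PartialRealization E O) : ℝ :=
  condExpect p ψ fun φ => π.expect φ fun S => f (ψ.dom ∪ S) φ - f ψ.dom φ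

/-- Adaptive monotonicity; conditioning is on partial realizations of positive probability. -/
def AdaptiveMonotone (p : PMF (E → O)) (f : Finset E → (E → O) → ℝ) : Prop :=
  ∀ ψ : PartialRealization E O, 0 < prob p ψ → ∀ e : E, 0 ≤ marginal p f {e} ψ

/-- `Ω(V, a)`: the policies that select at most `a` items, all of them from `V`. -/
def policiesFrom (O : Type v) (V : Finset E) (a : ℕ) : Set (Policy E O) :=
  {π | ∀ φ : E → O, ∀ S ∈ (π.selected φ).support, S ⊆ V ∧ S.card ≤ a}

/-- Full adaptive submodularity. -/
def FullyAdaptiveSubmodular (p : PMF (E → O)) (f : Finset E → (E → O) → ℝ) : Prop :=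
  ∀ ψ ψ' : PartialRealization E O, ψ.IsSub ψ' → 0 < prob p ψ' →
    ∀ (V : Finset E) (a : ℕ), 1 ≤ a → a ≤ V.card →
      sSup ((fun π => policyMarginal p f π ψ') '' policiesFrom O V a) ≤
        sSup ((fun π => policyMarginal p f π ψ) '' policiesFrom O V a)

/-- The policies that are feasible for the constraint `|E(π, φ) ∩ B i| ≤ d i` for all `i`. -/
def feasiblePolicies (O : Type v) {b : ℕ} (B : Fin b → Finset E) (d : Fin b → ℕ) :
    Set (Policy E O) :=
  {π | ∀ φ : E → O, ∀ S ∈ (π.selected φ).support, ∀ i, (S ∩ B i).card ≤ d i}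

end Utility

/-- An algorithm that has access to the objective function and to the prior only through a value
oracle. It may halt, query the oracle at an item and a partial realization, draw a random
subset of the ground set, or select an item and observe its state. -/
inductive Algorithm (E : Type u) (O : Type v) : Type (max u v)
  | halt : Algorithm E O
  | query (e : E) (ψ : PartialRealization E O) (next : ℝ → Algorithm E O) : Algorithm E O
  | sample (μ : PMF (Finset E)) (next : Finset E → Algorithm E O) : Algorithm E O
  | select (e : E) (next : O → Algorithm E O) : Algorithm E O

namespace Algorithm

variable {E : Type u} {O : Type v}

/-- The policy that an algorithm carries out when the queries are answered by `oracle`. -/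
def toPolicy (oracle : E → PartialRealization E O → ℝ) : Algorithm E O → Policy E O
  | .halt => .halt
  | .query e ψ next => (next (oracle e ψ)).toPolicy oracle
  | .sample μ next => .sample μ fun S => (next S).toPolicy oracle
  | .select e next => .select e fun o => (next o).toPolicy oracle

/-- The worst-case number of oracle queries, over all oracle answers, all outcomes of the random
draws, and all observed states. -/
def queryCount : Algorithm E O → ℕ∞
  | .halt => 0
  | .query _ _ next => 1 + ⨆ r, (next r).queryCount
  | .sample μ next => ⨆ S ∈ μ.support, (next S).queryCount
  | .select _ next => ⨆ o, (next o).queryCount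

/-- Query the oracle at all items of a list, record the answers, and continue with them. -/
def queryAll [DecidableEq E] (ψ : PartialRealization E O) (next : (E → ℝ) → Algorithm E O) :
    List E → (E → ℝ) → Algorithm E O
  | [], g => next g
  | e :: l, g => .query e ψ fun r => queryAll ψ next l (Function.update g e r)

end Algorithm

/-- A rule that returns, for a nonempty set `S` of items and values `g`, a maximizer of `g`
on `S`; ties may be broken in any way, also depending on the current partial realization. -/
structure ArgmaxRule (E : Type u) (O : Type v) where
  pick : PartialRealization E O → (S : Finset E) → S.Nonempty → (E → ℝ) → E
  pick_mem : ∀ ψ S hS (g : E → ℝ), pick ψ S hS g ∈ S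
  le_pick : ∀ ψ S hS (g : E → ℝ), ∀ e ∈ S, g e ≤ g (pick ψ S hS g)

/-- The sample size `(|B| / d) log (1 / ε)`, rounded up and capped at `|B|`. -/
def sampleSize {E : Type u} (B : Finset E) (d : ℕ) (ε : ℝ) : ℕ :=
  min ⌈(B.card : ℝ) / d * Real.log (1 / ε)⌉₊ B.card

/-- The uniform distribution on the subsets of `B` of size `sampleSize B d ε`. -/
def sampleLaw {E : Type u} (B : Finset E) (d : ℕ) (ε : ℝ) : PMF (Finset E) :=
  PMF.uniformOfFinset (B.powersetCard (sampleSize B d ε))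
    (Finset.powersetCard_nonempty.2 (min_le_right _ _))

section Greedy

variable {E : Type u} {O : Type v} [DecidableEq E]

/-- `r` rounds of adaptive stochastic greedy on the block `B` with cardinality constraint `d`,
starting from the observations `ψ`: in each round draw a random subset `S` of `B`, query the
conditional expected marginal utility of every item of `S`, and select a maximizer.
Afterwards, continue with `next`, which is given the observations made so far. -/
def stochasticGreedy (rule : ArgmaxRule E O) (ε : ℝ) (B : Finset E) (d : ℕ)
    (next : PartialRealization E O → Algorithm E O) :
    ℕ → PartialRealization E O → Algorithm E O
  | 0, ψ => next ψ
  | r + 1, ψ => .sample (sampleLaw B d ε) fun S =>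
      if hS : S.Nonempty then
        Algorithm.queryAll ψ
          (fun g => .select (rule.pick ψ S hS g) fun o =>
            stochasticGreedy rule ε B d next r
              (Function.update ψ (rule.pick ψ S hS g) (some o)))
          S.toList (fun _ => 0)
      else stochasticGreedy rule ε B d next r ψ

/-- Run `d` rounds of adaptive stochastic greedy on each block `(B, d)` of a list, in order. -/
def blockwiseGreedy (rule : ArgmaxRule E O) (ε : ℝ) :
    List (Finset E × ℕ) → PartialRealization E O → Algorithm E O
  | [], _ => .halt
  | (B, d) :: L, ψ => stochasticGreedy rule ε B d (blockwiseGreedy rule ε L) d ψ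

/-- Generalized Adaptive Stochastic Greedy for the blocks `B 0, B 1, …` with bounds `d 0, d 1, …`. -/
def generalizedStochasticGreedy (rule : ArgmaxRule E O) (ε : ℝ) {b : ℕ}
    (B : Fin b → Finset E) (d : Fin b → ℕ) : Algorithm E O :=
  blockwiseGreedy rule ε (List.ofFn fun i => (B i, d i)) fun _ => none

/-- The policy `π^gasg`: the value oracle answers a query at `e`, `ψ` with `Δ(e ∣ ψ)`. -/
def gasgPolicy [Fintype E] (p : PMF (E → O)) (f : Finset E → (E → O) → ℝ)
    (rule : ArgmaxRule E O) (ε : ℝ) {b : ℕ} (B : Fin b → Finset E) (d : Fin b → ℕ) :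
    Policy E O :=
  (generalizedStochasticGreedy rule ε B d).toPolicy fun e ψ => marginal p f {e} ψ

end Greedy

end AdaptiveSubmodular

end

/-! Let ψ be the random partial realization at which greedy stops, and let M be the sum over the
blocks of `topMarginal` at ψ. Both sides of the approximation bound are compared with 𝔼[M].

Greedy gains at least (1 - ε) 𝔼[M]. A random sample meets a best set of d items of the block with
probability at least 1 - ε, and by symmetry it favours none of them, so a round gains on average (1
- ε) / d times the current `topMarginal` (`le_sum_sampleLaw`). Marginals shrink as observations
accumulate (`FullyAdaptiveSubmodular.marginal_anti`), so the current value may be replaced by the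
value at the end of the whole run; this makes the gains of all rounds and blocks add up
(`stochasticGreedy_gain`, `blockwiseGreedy_gain`).

A feasible π run on top of ψ gains at most M on average (`consSum_expect_le_sum_topMarginal`), and
by monotonicity the union of both runs is worth at least π alone (`favg_le_tsum_union`). Hence (1 -
ε)(f_avg(π) - f_avg(greedy)) ≤ f_avg(greedy), which is the ratio (1 - ε) / (2 - ε); it dominates the
claimed one (`approximation_ratio_le`).

Full adaptive submodularity enters only for one-item sets V. Statements about runs are obtained by
induction on the decision tree, as submartingale arguments (`consSum_expect_nonneg`,
`consSum_expect_sub_nonneg`). -/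

namespace AdaptiveSubmodular

/-! ### Partial realizations. -/

section Basic

variable {E : Type u} {O : Type v} [Fintype E] [DecidableEq E]

namespace PartialRealization

/-- The partial realization that reveals the states of the items of `S` under `φ`. -/
def restrict (φ : E → O) (S : Finset E) : PartialRealization E O :=
  fun e => if e ∈ S then some (φ e) else none

omit [DecidableEq E] in
theorem mem_dom {ψ : PartialRealization E O} {e : E} : e ∈ ψ.dom ↔ ∃ o, ψ e = some o := by
  simp [dom, Option.isSome_iff_exists]

omit [DecidableEq E] in
theorem dom_empty : dom (fun _ => none : PartialRealization E O) = ∅ := by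
  ext e; simp [mem_dom]

theorem dom_update (ψ : PartialRealization E O) (e : E) (o : O) :
    dom (Function.update ψ e (some o)) = insert e ψ.dom := by
  ext x
  by_cases h : x = e
  · subst h; simp [mem_dom]
  · simp [mem_dom, h]

/-- A function of ψ thereby becomes a function of an item set and φ, the form in which the induction
over policies accepts it. -/
theorem restrict_dom {ψ : PartialRealization E O} {φ : E → O} (h : φ ∈ ψ.consistent) :
    restrict φ ψ.dom = ψ := by
  funext e
  unfold restrict
  split_ifs with he
  · obtain ⟨o, ho⟩ := mem_dom.1 he
    rw [ho, h e o ho]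
  · cases hψ : ψ e with
    | none => rfl
    | some o => exact absurd (mem_dom.2 ⟨o, hψ⟩) he

omit [Fintype E] in
theorem mem_consistent_restrict (φ : E → O) (S : Finset E) : φ ∈ (restrict φ S).consistent := by
  intro e o h
  unfold restrict at h
  split_ifs at h
  simpa using h

omit [Fintype E] in
theorem restrict_isSub_restrict (φ : E → O) {S T : Finset E} (h : S ⊆ T) :
    (restrict φ S).IsSub (restrict φ T) := by
  intro e o ho
  unfold restrict at ho ⊢
  split_ifs at ho with he
  rw [if_pos (h he), ho]

omit [Fintype E] in
-- The hypothesis `h` rules out that the update overwrites an observed state of `e` by a different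
-- one.
theorem mem_consistent_update {ψ : PartialRealization E O} {e : E} {o : O}
    (h : ψ.IsSub (Function.update ψ e (some o))) {φ : E → O} :
    φ ∈ consistent (Function.update ψ e (some o)) ↔ φ ∈ ψ.consistent ∧ φ e = o := by
  constructor
  · intro hφ
    exact ⟨fun x y hx => hφ x y (h x y hx), hφ e o (by simp)⟩
  · rintro ⟨hφ, rfl⟩ x y hx
    by_cases hxe : x = e
    · subst hxe; simpa using hx
    · rw [Function.update_of_ne hxe] at hx
      exact hφ x y hx

omit [Fintype E] in
theorem isSub_update_of_mem_consistent {ψ : PartialRealization E O} {φ : E → O}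
    (h : φ ∈ ψ.consistent) (e : E) : ψ.IsSub (Function.update ψ e (some (φ e))) := by
  intro x y hx
  by_cases hxe : x = e
  · subst hxe; simp [h x y hx]
  · rwa [Function.update_of_ne hxe]

omit [Fintype E] [DecidableEq E] in
theorem IsSub.trans {ψ₁ ψ₂ ψ₃ : PartialRealization E O} (h : ψ₁.IsSub ψ₂) (h' : ψ₂.IsSub ψ₃) :
    ψ₁.IsSub ψ₃ := fun e o ho => h' e o (h e o ho)

omit [Fintype E] [DecidableEq E] in
theorem IsSub.consistent_subset {ψ₁ ψ₂ : PartialRealization E O} (h : ψ₁.IsSub ψ₂) :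
    ψ₂.consistent ⊆ ψ₁.consistent := fun _ hφ e o ho => hφ e o (h e o ho)

end PartialRealization

open PartialRealization

/-! ### Expectation over the items selected by a policy. -/

namespace Policy

theorem expect_halt (φ : E → O) (g : Finset E → ℝ) : (halt : Policy E O).expect φ g = g ∅ := by
  unfold expect selected
  rw [Finset.sum_eq_single ∅] <;> simp +contextual [PMF.pure_apply]

theorem expect_sample (μ : PMF (Finset E)) (next : Finset E → Policy E O) (φ : E → O)
    (g : Finset E → ℝ) :
    (sample μ next).expect φ g = ∑ S, (μ S).toReal * (next S).expect φ g := by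
  unfold expect
  simp_rw [Finset.mul_sum]
  rw [Finset.sum_comm]
  refine Finset.sum_congr rfl fun T _ => ?_
  rw [selected, PMF.bind_apply, tsum_fintype, ENNReal.toReal_sum, Finset.sum_mul]
  · simp [ENNReal.toReal_mul, mul_assoc]
  · exact fun S _ => ENNReal.mul_ne_top (PMF.apply_ne_top _ _) (PMF.apply_ne_top _ _)

theorem expect_select (e : E) (next : O → Policy E O) (φ : E → O) (g : Finset E → ℝ) :
    (select e next).expect φ g = (next (φ e)).expect φ fun S => g (insert e S) := by
  unfold expect
  have h (T : Finset E) : ((select e next).selected φ T).toReal * g T =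
      ∑ S, if T = insert e S then ((next (φ e)).selected φ S).toReal * g (insert e S) else 0 := by
    rw [selected, PMF.map_apply, tsum_fintype, ENNReal.toReal_sum, Finset.sum_mul]
    · refine Finset.sum_congr rfl fun S _ => ?_
      split_ifs with hT
      · rw [hT]
      · simp
    · intro S _
      split_ifs
      · exact PMF.apply_ne_top _ _
      · simp
  simp_rw [h]
  rw [Finset.sum_comm]
  simp

theorem sum_selected (π : Policy E O) (φ : E → O) : ∑ S, (π.selected φ S).toReal = 1 := by
  rw [← ENNReal.toReal_sum fun S _ => PMF.apply_ne_top _ _, ← tsum_fintype (L := .unconditional _),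
    PMF.tsum_coe, ENNReal.toReal_one]

theorem expect_const (π : Policy E O) (φ : E → O) (c : ℝ) : (π.expect φ fun _ => c) = c := by
  unfold expect
  rw [← Finset.sum_mul, sum_selected, one_mul]

theorem expect_add (π : Policy E O) (φ : E → O) (g h : Finset E → ℝ) :
    (π.expect φ fun S => g S + h S) = π.expect φ g + π.expect φ h := by
  simp [expect, mul_add, Finset.sum_add_distrib]

theorem expect_sub (π : Policy E O) (φ : E → O) (g h : Finset E → ℝ) :
    (π.expect φ fun S => g S - h S) = π.expect φ g - π.expect φ h := by
  simp [expect, mul_sub, Finset.sum_sub_distrib]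

theorem expect_mul_left (π : Policy E O) (φ : E → O) (c : ℝ) (g : Finset E → ℝ) :
    (π.expect φ fun S => c * g S) = c * π.expect φ g := by
  simp [expect, Finset.mul_sum, mul_left_comm]

theorem expect_mono (π : Policy E O) (φ : E → O) {g h : Finset E → ℝ}
    (H : ∀ S ∈ (π.selected φ).support, g S ≤ h S) : π.expect φ g ≤ π.expect φ h := by
  refine Finset.sum_le_sum fun S _ => ?_
  by_cases hS : S ∈ (π.selected φ).support
  · exact mul_le_mul_of_nonneg_left (H S hS) ENNReal.toReal_nonneg
  · rw [PMF.mem_support_iff, not_not] at hS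
    simp [hS]

theorem expect_expect_comm (π π' : Policy E O) (φ : E → O) (g : Finset E → Finset E → ℝ) :
    (π.expect φ fun S => π'.expect φ fun T => g S T) =
      π'.expect φ fun T => π.expect φ fun S => g S T := by
  unfold expect
  simp_rw [Finset.mul_sum]
  rw [Finset.sum_comm]
  simp_rw [mul_left_comm]

end Policy

/-! ### Summability and sums over consistent realizations. -/

variable (p : PMF (E → O))

omit [Fintype E] [DecidableEq E] in
theorem summable_toReal : Summable fun φ => (p φ).toReal :=
  ENNReal.summable_toReal p.tsum_coe_ne_top

variable {p}

omit [Fintype E] [DecidableEq E] in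
theorem summable_of_bounded {g : (E → O) → ℝ} (C : ℝ) (h : ∀ φ, p φ ≠ 0 → |g φ| ≤ C) :
    Summable fun φ => (p φ).toReal * g φ := by
  refine Summable.of_norm_bounded ((summable_toReal p).mul_right C) fun φ => ?_
  by_cases hφ : p φ = 0
  · simp [hφ]
  · rw [norm_mul, Real.norm_of_nonneg ENNReal.toReal_nonneg]
    exact mul_le_mul_of_nonneg_left (h φ hφ) ENNReal.toReal_nonneg

omit [Fintype E] [DecidableEq E] in
theorem summable_add {g h : (E → O) → ℝ} (hg : Summable fun φ => (p φ).toReal * g φ)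
    (hh : Summable fun φ => (p φ).toReal * h φ) :
    Summable fun φ => (p φ).toReal * (g φ + h φ) := by
  simpa [mul_add] using hg.add hh

omit [Fintype E] [DecidableEq E] in
theorem summable_sub {g h : (E → O) → ℝ} (hg : Summable fun φ => (p φ).toReal * g φ)
    (hh : Summable fun φ => (p φ).toReal * h φ) :
    Summable fun φ => (p φ).toReal * (g φ - h φ) := by
  simpa [mul_sub] using hg.sub hh

omit [Fintype E] [DecidableEq E] in
theorem summable_const_mul {g : (E → O) → ℝ} (c : ℝ)
    (hg : Summable fun φ => (p φ).toReal * g φ) :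
    Summable fun φ => (p φ).toReal * (c * g φ) := by
  simpa [mul_left_comm] using hg.mul_left c

omit [Fintype E] [DecidableEq E] in
theorem summable_const (c : ℝ) : Summable fun φ => (p φ).toReal * c :=
  (summable_toReal p).mul_right c

/-- The policy may depend on `φ`, as it does for the part of a run after an observation. -/
theorem summable_expect (π : (E → O) → Policy E O) {K : Finset E → (E → O) → ℝ}
    (hK : ∀ S, Summable fun φ => (p φ).toReal * K S φ) :
    Summable fun φ => (p φ).toReal * (π φ).expect φ fun S => K S φ := by
  simp_rw [Policy.expect, Finset.mul_sum]
  refine summable_sum fun S _ => ?_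
  refine Summable.of_norm_bounded (hK S).norm fun φ => ?_
  rw [mul_left_comm, norm_mul, Real.norm_of_nonneg ENNReal.toReal_nonneg]
  refine mul_le_of_le_one_left (norm_nonneg _) ?_
  exact ENNReal.toReal_le_of_le_ofReal zero_le_one (by simpa using PMF.coe_le_one _ _)

variable (p)

/-- The unnormalized conditional expectation `𝔼[g(Φ) ; Φ ∼ ψ]`. -/
noncomputable def consSum (ψ : PartialRealization E O) (g : (E → O) → ℝ) : ℝ :=
  ∑' φ, ψ.consistent.indicator (fun φ => (p φ).toReal * g φ) φ

variable {p}

omit [Fintype E] [DecidableEq E] in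
theorem consSum_congr {ψ : PartialRealization E O} {g h : (E → O) → ℝ}
    (H : ∀ φ ∈ ψ.consistent, g φ = h φ) : consSum p ψ g = consSum p ψ h := by
  refine tsum_congr fun φ => ?_
  by_cases hφ : φ ∈ ψ.consistent
  · simp [hφ, H φ hφ]
  · simp [hφ]

omit [Fintype E] [DecidableEq E] in
theorem consSum_mono {ψ : PartialRealization E O} {g h : (E → O) → ℝ}
    (hg : Summable fun φ => (p φ).toReal * g φ) (hh : Summable fun φ => (p φ).toReal * h φ)
    (H : ∀ φ ∈ ψ.consistent, p φ ≠ 0 → g φ ≤ h φ) : consSum p ψ g ≤ consSum p ψ h := by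
  refine Summable.tsum_le_tsum (fun φ => ?_) (hg.indicator _) (hh.indicator _)
  by_cases hφ : φ ∈ ψ.consistent
  · by_cases h0 : p φ = 0
    · simp [hφ, h0]
    · simpa [hφ] using mul_le_mul_of_nonneg_left (H φ hφ h0) ENNReal.toReal_nonneg
  · simp [hφ]

omit [Fintype E] [DecidableEq E] in
theorem consSum_add {ψ : PartialRealization E O} {g h : (E → O) → ℝ}
    (hg : Summable fun φ => (p φ).toReal * g φ) (hh : Summable fun φ => (p φ).toReal * h φ) :
    (consSum p ψ fun φ => g φ + h φ) = consSum p ψ g + consSum p ψ h := by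
  unfold consSum
  rw [← (hg.indicator _).tsum_add (hh.indicator _)]
  simp_rw [mul_add, Set.indicator_add]

omit [Fintype E] [DecidableEq E] in
theorem consSum_const_mul (ψ : PartialRealization E O) (c : ℝ) (g : (E → O) → ℝ) :
    (consSum p ψ fun φ => c * g φ) = c * consSum p ψ g := by
  unfold consSum
  rw [← tsum_mul_left]
  refine tsum_congr fun φ => ?_
  by_cases hφ : φ ∈ ψ.consistent <;> simp [hφ, mul_left_comm]

omit [Fintype E] [DecidableEq E] in
theorem consSum_sub {ψ : PartialRealization E O} {g h : (E → O) → ℝ}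
    (hg : Summable fun φ => (p φ).toReal * g φ) (hh : Summable fun φ => (p φ).toReal * h φ) :
    (consSum p ψ fun φ => g φ - h φ) = consSum p ψ g - consSum p ψ h := by
  have := consSum_add (ψ := ψ) hg (summable_const_mul (-1) hh)
  rw [consSum_const_mul] at this
  simpa [sub_eq_add_neg] using this

omit [Fintype E] [DecidableEq E] in
theorem consSum_const (ψ : PartialRealization E O) (c : ℝ) :
    (consSum p ψ fun _ => c) = prob p ψ * c := by
  have := consSum_const_mul (p := p) ψ c fun _ => 1
  simp only [mul_one] at this
  rw [this, mul_comm]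
  simp [consSum, prob]

omit [Fintype E] [DecidableEq E] in
theorem consSum_sum {ι : Type*} (s : Finset ι) {ψ : PartialRealization E O}
    {g : ι → (E → O) → ℝ} (hg : ∀ i, Summable fun φ => (p φ).toReal * g i φ) :
    (consSum p ψ fun φ => ∑ i ∈ s, g i φ) = ∑ i ∈ s, consSum p ψ (g i) := by
  unfold consSum
  rw [← Summable.tsum_finsetSum fun i _ => (hg i).indicator _]
  refine tsum_congr fun φ => ?_
  by_cases hφ : φ ∈ ψ.consistent <;> simp [hφ, Finset.mul_sum]

omit [Fintype E] [DecidableEq E] in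
theorem prob_nonneg (ψ : PartialRealization E O) : 0 ≤ prob p ψ :=
  tsum_nonneg fun φ => Set.indicator_nonneg (fun _ _ => ENNReal.toReal_nonneg) φ

omit [Fintype E] [DecidableEq E] in
theorem prob_pos {ψ : PartialRealization E O} {φ : E → O} (h : φ ∈ ψ.consistent) (hφ : p φ ≠ 0) :
    0 < prob p ψ := by
  refine ((summable_toReal p).indicator _).tsum_pos
    (fun φ => Set.indicator_nonneg (fun _ _ => ENNReal.toReal_nonneg) φ) φ ?_
  simpa [h] using ENNReal.toReal_pos hφ (PMF.apply_ne_top _ _)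

omit [Fintype E] [DecidableEq E] in
theorem prob_anti {ψ ψ' : PartialRealization E O} (h : ψ.IsSub ψ') : prob p ψ' ≤ prob p ψ := by
  refine Summable.tsum_le_tsum (fun φ => ?_) ((summable_toReal p).indicator _)
    ((summable_toReal p).indicator _)
  exact Set.indicator_le_indicator_of_subset h.consistent_subset
    (fun _ => ENNReal.toReal_nonneg) φ

omit [Fintype E] [DecidableEq E] in
theorem consSum_eq_zero {ψ : PartialRealization E O} (h : prob p ψ = 0) (g : (E → O) → ℝ) :
    consSum p ψ g = 0 := by
  unfold consSum
  rw [← tsum_zero (α := ℝ) (β := E → O)]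
  refine tsum_congr fun φ => ?_
  by_cases hφ : φ ∈ ψ.consistent
  · by_cases h0 : p φ = 0
    · simp [h0]
    · exact absurd h (prob_pos hφ h0).ne'
  · simp [hφ]

omit [Fintype E] [DecidableEq E] in
-- Both sides vanish on null events. Working with `consSum` instead of `condExpect` thus makes null
-- partial realizations harmless in inductions.
theorem consSum_eq_prob_mul_condExpect (ψ : PartialRealization E O) (g : (E → O) → ℝ) :
    consSum p ψ g = prob p ψ * condExpect p ψ g := by
  rcases (prob_nonneg (p := p) ψ).eq_or_lt with h | h
  · rw [consSum_eq_zero h.symm, ← h, zero_mul]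
  · rw [condExpect, mul_div_cancel₀ _ h.ne']; rfl

omit [Fintype E] [DecidableEq E] in
theorem consSum_empty (g : (E → O) → ℝ) :
    consSum p (fun _ => none) g = ∑' φ, (p φ).toReal * g φ := by
  refine tsum_congr fun φ => ?_
  rw [Set.indicator_of_mem]
  intro e o h
  simp at h

/-! ### Conditioning and induction over decision trees. -/

omit [Fintype E] in
/-- Conditioning on the state of one more item. -/
theorem consSum_nonneg_of_update {ψ : PartialRealization E O} (e : E) {g : (E → O) → ℝ}
    (hg : Summable fun φ => (p φ).toReal * g φ)
    (h : ∀ o, ψ.IsSub (Function.update ψ e (some o)) →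
      0 ≤ consSum p (Function.update ψ e (some o)) g) : 0 ≤ consSum p ψ g := by
  -- Sort the realizations by the state of `e`.
  have hs := (hg.indicator ψ.consistent).hasSum.tsum_fiberwise fun φ => φ e
  refine hs.nonneg fun o => ?_
  rw [tsum_subtype ((fun φ : E → O => φ e) ⁻¹' {o})
    (ψ.consistent.indicator fun φ => (p φ).toReal * g φ)]
  by_cases ho : ψ.IsSub (Function.update ψ e (some o))
  · refine (h o ho).trans_eq (tsum_congr fun φ => ?_)
    rw [Set.indicator_indicator]
    congr 1
    ext φ'
    rw [mem_consistent_update ho]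
    simp [and_comm]
  -- Here ψ already records another state of `e`, so this fibre contributes only zeros.
  · refine tsum_nonneg fun φ => ?_
    by_cases hφ : φ ∈ ψ.consistent
    · rw [Set.indicator_of_notMem]
      rintro rfl
      exact ho (isSub_update_of_mem_consistent hφ e)
    · simp [Set.indicator_indicator, Set.indicator_of_notMem, hφ]

/-- A quantity with nonnegative conditional mean at every partial realization has nonnegative mean
at the end of every policy. -/
theorem consSum_expect_nonneg {K : Finset E → (E → O) → ℝ}
    (hs : ∀ S, Summable fun φ => (p φ).toReal * K S φ)
    (hK : ∀ ψ : PartialRealization E O, 0 ≤ consSum p ψ (K ψ.dom)) (π : Policy E O) :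
    ∀ ψ : PartialRealization E O,
      0 ≤ consSum p ψ fun φ => π.expect φ fun S => K (ψ.dom ∪ S) φ := by
  induction π with
  | halt =>
    intro ψ
    simpa [Policy.expect_halt] using hK ψ
  | sample μ next ih =>
    intro ψ
    simp_rw [Policy.expect_sample]
    rw [consSum_sum]
    · refine Finset.sum_nonneg fun S _ => ?_
      rw [consSum_const_mul]
      exact mul_nonneg ENNReal.toReal_nonneg (ih S ψ)
    · exact fun S => summable_const_mul _ (summable_expect (fun _ => next S) fun T => hs _)
  | select e next ih =>
    intro ψ
    simp_rw [Policy.expect_select]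
    refine consSum_nonneg_of_update e
      (summable_expect (fun φ => next (φ e)) (K := fun S => K (ψ.dom ∪ insert e S)) fun S => hs _)
      fun o ho => ?_
    refine (ih o (Function.update ψ e (some o))).trans_eq (consSum_congr fun φ hφ => ?_)
    rw [((mem_consistent_update ho).1 hφ).2, dom_update]
    simp_rw [Finset.insert_union, Finset.union_insert]

/-- A process with nonnegative conditional mean increments has a nonnegative mean increment over
every policy. -/
theorem consSum_expect_sub_nonneg {K : Finset E → (E → O) → ℝ}
    (hs : ∀ S, Summable fun φ => (p φ).toReal * K S φ) (ψ₀ : PartialRealization E O)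
    (hK : ∀ ψ : PartialRealization E O, ψ₀.IsSub ψ → ∀ e ∉ ψ.dom,
      0 ≤ consSum p ψ fun φ => K (insert e ψ.dom) φ - K ψ.dom φ) (π : Policy E O) :
    ∀ ψ : PartialRealization E O, ψ₀.IsSub ψ →
      0 ≤ consSum p ψ fun φ => π.expect φ fun S => K (ψ.dom ∪ S) φ - K ψ.dom φ := by
  induction π with
  | halt =>
    intro ψ _
    simp [Policy.expect_halt, consSum_const]
  | sample μ next ih =>
    intro ψ hψ
    simp_rw [Policy.expect_sample]
    rw [consSum_sum]
    · refine Finset.sum_nonneg fun S _ => ?_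
      rw [consSum_const_mul]
      exact mul_nonneg ENNReal.toReal_nonneg (ih S ψ hψ)
    · exact fun S => summable_const_mul _
        (summable_expect (fun _ => next S) fun T => summable_sub (hs _) (hs _))
  | select e next ih =>
    intro ψ hψ
    simp_rw [Policy.expect_select]
    -- The increment is split at `insert e ψ.dom`: `hK` controls the selection of `e`, the induction
    -- hypothesis the rest. Selecting an observed item again changes nothing.
    have hstep : 0 ≤ consSum p ψ fun φ => K (insert e ψ.dom) φ - K ψ.dom φ := by
      by_cases he : e ∈ ψ.dom
      · simp [Finset.insert_eq_of_mem he, consSum_const]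
      · exact hK ψ hψ e he
    have hrest : 0 ≤ consSum p ψ fun φ => (next (φ e)).expect φ fun S =>
        K (ψ.dom ∪ insert e S) φ - K (insert e ψ.dom) φ := by
      refine consSum_nonneg_of_update e (summable_expect (fun φ => next (φ e))
        (K := fun S φ => K (ψ.dom ∪ insert e S) φ - K (insert e ψ.dom) φ)
        fun S => summable_sub (hs _) (hs _)) fun o ho => ?_
      refine (ih o (Function.update ψ e (some o)) (hψ.trans ho)).trans_eq
        (consSum_congr fun φ hφ => ?_)
      rw [((mem_consistent_update ho).1 hφ).2, dom_update]
      simp_rw [Finset.insert_union, Finset.union_insert]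
    refine (add_nonneg hrest hstep).trans_eq ?_
    rw [← consSum_add]
    · refine consSum_congr fun φ _ => ?_
      simp_rw [Policy.expect_sub, Policy.expect_const]
      ring
    · exact summable_expect (fun φ => next (φ e))
        (K := fun S φ => K (ψ.dom ∪ insert e S) φ - K (insert e ψ.dom) φ)
        fun S => summable_sub (hs _) (hs _)
    · exact summable_sub (hs _) (hs _)

end Basic

/-! ### Random samples and the greedy choice within them. -/

section Sampling

variable {E : Type u} [DecidableEq E]

/-- The largest sum of `c` over a subset of `B` with at most `d` elements. -/
noncomputable def topSum (B : Finset E) (d : ℕ) (c : E → ℝ) : ℝ :=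
  (B.powerset.filter fun T => T.card ≤ d).sup' ⟨∅, by simp⟩ fun T => ∑ e ∈ T, c e

omit [DecidableEq E] in
theorem sum_le_topSum {B T : Finset E} {d : ℕ} (c : E → ℝ) (hT : T ⊆ B) (hd : T.card ≤ d) :
    ∑ e ∈ T, c e ≤ topSum B d c :=
  Finset.le_sup' (fun T => ∑ e ∈ T, c e) (by simp [hT, hd])

omit [DecidableEq E] in
theorem topSum_nonneg (B : Finset E) (d : ℕ) (c : E → ℝ) : 0 ≤ topSum B d c := by
  simpa using sum_le_topSum (B := B) (T := ∅) (d := d) c (by simp) (by simp)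

omit [DecidableEq E] in
theorem exists_topSum_eq (B : Finset E) (d : ℕ) (c : E → ℝ) :
    ∃ T ⊆ B, T.card ≤ d ∧ topSum B d c = ∑ e ∈ T, c e := by
  obtain ⟨T, hT, h⟩ := Finset.exists_mem_eq_sup'
    (s := B.powerset.filter fun T => T.card ≤ d) ⟨∅, by simp⟩ fun T => ∑ e ∈ T, c e
  simp only [Finset.mem_filter, Finset.mem_powerset] at hT
  exact ⟨T, hT.1, hT.2, h⟩

omit [DecidableEq E] in
theorem topSum_mono (B : Finset E) (d : ℕ) {c c' : E → ℝ} (h : ∀ e, c e ≤ c' e) :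
    topSum B d c ≤ topSum B d c' := by
  obtain ⟨T, hT, hd, h'⟩ := exists_topSum_eq B d c
  rw [h']
  exact (Finset.sum_le_sum fun e _ => h e).trans (sum_le_topSum c' hT hd)

/-- Drawing without replacement avoids `d` given elements at most as often as drawing with
replacement: each factor (n - d - s) / (n - s) is at most 1 - d / n. -/
theorem choose_sub_le {n d : ℕ} (hd : d ≤ n) (hn : 0 < n) (s : ℕ) :
    ((n - d).choose s : ℝ) ≤ (1 - (d : ℝ) / n) ^ s * n.choose s := by
  have hn' : (0 : ℝ) < n := by exact_mod_cast hn
  have hdn : (d : ℝ) ≤ n := by exact_mod_cast hd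
  have hq : (0 : ℝ) ≤ 1 - (d : ℝ) / n := by
    rw [sub_nonneg, div_le_one hn']; exact hdn
  induction s with
  | zero => simp
  | succ s ih =>
    rcases Nat.lt_or_ge s (n - d) with hs | hs
    · have h1 : ((n - d).choose (s + 1) : ℝ) * (s + 1) = (n - d).choose s * (n - d - s) := by
        have := Nat.choose_succ_right_eq (n - d) s
        have h := congrArg (Nat.cast (R := ℝ)) this
        rw [Nat.cast_mul, Nat.cast_mul, Nat.cast_sub hs.le, Nat.cast_sub hd] at h
        push_cast at h
        exact h
      have h2 : (n.choose (s + 1) : ℝ) * (s + 1) = n.choose s * (n - s) := by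
        have := Nat.choose_succ_right_eq n s
        have h := congrArg (Nat.cast (R := ℝ)) this
        rw [Nat.cast_mul, Nat.cast_mul, Nat.cast_sub (by omega)] at h
        push_cast at h
        exact h
      have hs' : (0 : ℝ) ≤ n - d - s := by
        have : (s : ℝ) ≤ ((n - d : ℕ) : ℝ) := by exact_mod_cast hs.le
        rw [Nat.cast_sub hd] at this
        linarith
      have h3 : (n - d - s : ℝ) ≤ (1 - (d : ℝ) / n) * (n - s) := by
        have : (1 - (d : ℝ) / n) * (n - s) = n - d - s + d * s / n := by
          field_simp; ring
        rw [this]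
        have : (0 : ℝ) ≤ d * s / n := by positivity
        linarith
      refine le_of_mul_le_mul_right ?_ (show (0 : ℝ) < s + 1 by positivity)
      calc ((n - d).choose (s + 1) : ℝ) * (s + 1) = (n - d).choose s * (n - d - s) := h1
        _ ≤ ((1 - (d : ℝ) / n) ^ s * n.choose s) * ((1 - (d : ℝ) / n) * (n - s)) :=
          mul_le_mul ih h3 hs' (by positivity)
        _ = (1 - (d : ℝ) / n) ^ (s + 1) * (n.choose s * (n - s)) := by ring
        _ = _ := by rw [← h2]; ring
    · rw [Nat.choose_eq_zero_of_lt (by omega), Nat.cast_zero]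
      positivity

/-- By symmetry, a uniformly random subset of `B` that meets `A` is equally likely to
single out each element of `A`. -/
theorem sum_meeting_le [Fintype E] {A B : Finset E} (hA : A ⊆ B) (s : ℕ) {c : E → ℝ}
    {m : Finset E → ℝ} (hm : ∀ S ∈ B.powersetCard s, ∀ e ∈ S, c e ≤ m S)
    (hm0 : ∀ S ∈ B.powersetCard s, 0 ≤ m S) :
    (((B.powersetCard s).filter fun S => ¬ Disjoint S A).card : ℝ) * ∑ a ∈ A, c a ≤
      A.card * ∑ S ∈ B.powersetCard s, m S := by
  -- Up to normalization, `q a` is the probability that `a` comes out when a uniform sample is drawn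
  -- and then a uniform element of its intersection with `A`.
  let q : E → ℝ := fun a => ∑ S : Finset E,
    if S ∈ B.powersetCard s ∧ a ∈ S then ((S ∩ A).card : ℝ)⁻¹ else 0
  have hsymm : ∀ a ∈ A, ∀ a' ∈ A, q a = q a' := by
    intro a ha a' ha'
    -- The transposition of `a` and `a'` preserves `A` and `B`, hence permutes the samples and keeps
    -- the weights.
    refine Fintype.sum_equiv (Equiv.swap a a').finsetCongr _ _ fun S => ?_
    have hinv {T : Finset E} (h : a ∈ T) (h' : a' ∈ T) :
        T.map (Equiv.swap a a').toEmbedding = T := by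
      refine Finset.eq_of_subset_of_card_le (fun x hx => ?_) (by simp)
      obtain ⟨y, hy, rfl⟩ := Finset.mem_map.1 hx
      simp only [Equiv.coe_toEmbedding, Equiv.swap_apply_def]
      split_ifs <;> assumption
    have h1 : S.map (Equiv.swap a a').toEmbedding ∈ B.powersetCard s ↔ S ∈ B.powersetCard s := by
      rw [Finset.mem_powersetCard, Finset.mem_powersetCard, Finset.card_map]
      nth_rw 1 [← hinv (hA ha) (hA ha')]
      rw [Finset.map_subset_map]
    have h2 : a' ∈ S.map (Equiv.swap a a').toEmbedding ↔ a ∈ S := by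
      rw [Finset.mem_map_equiv]
      simp
    have h3 : (S.map (Equiv.swap a a').toEmbedding ∩ A).card = (S ∩ A).card := by
      nth_rw 1 [← hinv ha ha']
      rw [← Finset.map_inter, Finset.card_map]
    simp only [Equiv.finsetCongr_apply, h1, h2, h3]
  have hq (g : E → ℝ) : ∑ a ∈ A, g a * q a =
      ∑ S ∈ B.powersetCard s, ∑ a ∈ S ∩ A, g a * ((S ∩ A).card : ℝ)⁻¹ := by
    simp only [q, Finset.mul_sum]
    rw [Finset.sum_comm, ← Finset.sum_subset (Finset.subset_univ (B.powersetCard s))]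
    · refine Finset.sum_congr rfl fun S hS => ?_
      rw [Finset.inter_comm, ← Finset.filter_mem_eq_inter, Finset.sum_filter]
      refine Finset.sum_congr rfl fun a _ => ?_
      simp [hS]
    · intro S _ hS
      exact Finset.sum_eq_zero fun a _ => by simp [hS]
  have hcount : ∑ a ∈ A, q a =
      (((B.powersetCard s).filter fun S => ¬ Disjoint S A).card : ℝ) := by
    have := hq fun _ => 1
    simp only [one_mul] at this
    rw [this, Finset.card_filter]
    push_cast
    refine Finset.sum_congr rfl fun S _ => ?_
    rw [Finset.sum_const, nsmul_eq_mul]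
    split_ifs with h
    · rw [Finset.disjoint_iff_inter_eq_empty] at h
      simp [h]
    · refine mul_inv_cancel₀ ?_
      rw [Finset.not_disjoint_iff_nonempty_inter] at h
      exact_mod_cast h.card_pos.ne'
  -- The average of `c` over the part of the sample in `A` is at most `m S`.
  have hmain : ∑ a ∈ A, c a * q a ≤ ∑ S ∈ B.powersetCard s, m S := by
    rw [hq]
    refine Finset.sum_le_sum fun S hS => ?_
    rcases (S ∩ A).eq_empty_or_nonempty with h | h
    · rw [h, Finset.sum_empty]; exact hm0 S hS
    · rw [← Finset.sum_mul, ← div_eq_mul_inv, div_le_iff₀ (by exact_mod_cast h.card_pos), mul_comm,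
        ← nsmul_eq_mul]
      exact Finset.sum_le_card_nsmul _ _ _ fun a ha => hm S hS a (Finset.mem_inter.1 ha).1
  rcases A.eq_empty_or_nonempty with rfl | ⟨a₀, ha₀⟩
  · simp
  · have h1 : ∑ a ∈ A, q a = A.card * q a₀ := by
      rw [Finset.sum_congr rfl fun a ha => hsymm a ha a₀ ha₀, Finset.sum_const, nsmul_eq_mul]
    have h2 : ∑ a ∈ A, c a * q a = (∑ a ∈ A, c a) * q a₀ := by
      rw [Finset.sum_mul]
      exact Finset.sum_congr rfl fun a ha => by rw [hsymm a ha a₀ ha₀]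
    rw [← hcount, h1]
    rw [h2] at hmain
    nlinarith [mul_le_mul_of_nonneg_left hmain (Nat.cast_nonneg (α := ℝ) A.card)]

omit [DecidableEq E] in
theorem sampleSize_le_card (B : Finset E) (d : ℕ) (ε : ℝ) : sampleSize B d ε ≤ B.card :=
  min_le_right _ _

theorem log_one_div_pos {ε : ℝ} (h0 : 0 < ε) (h1 : ε < 1) : 0 < Real.log (1 / ε) :=
  Real.log_pos (by rw [lt_div_iff₀ h0]; linarith)

omit [DecidableEq E] in
theorem sampleSize_pos {B : Finset E} {d : ℕ} {ε : ℝ} (h0 : 0 < ε) (h1 : ε < 1) (hd : 0 < d)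
    (hB : d ≤ B.card) : 0 < sampleSize B d ε := by
  have hL := log_one_div_pos h0 h1
  have hB' : 0 < B.card := hd.trans_le hB
  exact lt_min (Nat.ceil_pos.2 (by positivity)) hB'

/-- A random sample misses a set of `d` elements of `B` with probability at most `ε`. -/
theorem card_disjoint_le {A B : Finset E} {d : ℕ} {ε : ℝ} (h0 : 0 < ε) (hd : 0 < d)
    (hA : A ⊆ B) (hAd : A.card = d) :
    (((B.powersetCard (sampleSize B d ε)).filter fun S => Disjoint S A).card : ℝ) ≤
      ε * (B.powersetCard (sampleSize B d ε)).card := by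
  have hB : d ≤ B.card := hAd ▸ Finset.card_le_card hA
  have hn : 0 < B.card := hd.trans_le hB
  have hn' : (0 : ℝ) < B.card := by exact_mod_cast hn
  have hd' : (0 : ℝ) < d := by exact_mod_cast hd
  have heq : ((B.powersetCard (sampleSize B d ε)).filter fun S => Disjoint S A) =
      (B \ A).powersetCard (sampleSize B d ε) := by
    ext S
    simp only [Finset.mem_filter, Finset.mem_powersetCard, Finset.subset_sdiff]
    tauto
  rw [heq, Finset.card_powersetCard, Finset.card_powersetCard, Finset.card_sdiff_of_subset hA, hAd]
  rcases le_total ⌈(B.card : ℝ) / d * Real.log (1 / ε)⌉₊ B.card with h | h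
  -- Uncapped sample size s ≥ (|B| / d) log (1 / ε): then (1 - d / |B|) ^ s ≤ exp (-d s / |B|) ≤ ε.
  · refine (choose_sub_le hB hn _).trans (mul_le_mul_of_nonneg_right ?_ (Nat.cast_nonneg _))
    have hs : (B.card : ℝ) / d * Real.log (1 / ε) ≤ (sampleSize B d ε : ℝ) := by
      rw [sampleSize, min_eq_left h]
      exact Nat.le_ceil _
    have hq : (0 : ℝ) ≤ 1 - (d : ℝ) / B.card := by
      rw [sub_nonneg, div_le_one hn']; exact_mod_cast hB
    calc (1 - (d : ℝ) / B.card) ^ sampleSize B d ε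
        ≤ Real.exp (-((d : ℝ) / B.card)) ^ sampleSize B d ε :=
          pow_le_pow_left₀ hq (Real.one_sub_le_exp_neg _) _
      _ = Real.exp (-((d : ℝ) / B.card * sampleSize B d ε)) := by
          rw [← Real.exp_nat_mul]; ring_nf
      _ ≤ Real.exp (Real.log ε) := by
          refine Real.exp_le_exp.2 ?_
          have := mul_le_mul_of_nonneg_left hs (show (0 : ℝ) ≤ (d : ℝ) / B.card by positivity)
          rw [← mul_assoc, div_mul_div_cancel₀ hn'.ne', div_self hd'.ne', one_mul, one_div,
            Real.log_inv] at this
          linarith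
      _ = ε := Real.exp_log h0
  -- Capped size: the sample is all of `B` and misses nothing, as `d > 0`.
  · rw [sampleSize, min_eq_right h, Nat.choose_eq_zero_of_lt (by omega)]
    simp only [Nat.cast_zero]
    positivity

omit [DecidableEq E] in
theorem sum_sampleLaw [Fintype E] (B : Finset E) (d : ℕ) (ε : ℝ) (m : Finset E → ℝ) :
    ∑ S, (sampleLaw B d ε S).toReal * m S =
      ((B.powersetCard (sampleSize B d ε)).card : ℝ)⁻¹ *
        ∑ S ∈ B.powersetCard (sampleSize B d ε), m S := by
  rw [Finset.mul_sum, ← Finset.sum_subset (Finset.subset_univ (B.powersetCard _))]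
  · refine Finset.sum_congr rfl fun S hS => ?_
    rw [sampleLaw, PMF.uniformOfFinset_apply_of_mem _ hS]
    simp
  · intro S _ hS
    rw [sampleLaw, PMF.uniformOfFinset_apply_of_notMem _ hS]
    simp

/-- The expected maximum over a random sample is at least `(1 - ε) / d` times the sum of the `d`
largest values. -/
theorem le_sum_sampleLaw [Fintype E] {B : Finset E} {d : ℕ} {ε : ℝ} (h0 : 0 < ε) (hd : 0 < d)
    (hB : d ≤ B.card) {c : E → ℝ} (hc : ∀ e, 0 ≤ c e) {m : Finset E → ℝ}
    (hm : ∀ S ∈ B.powersetCard (sampleSize B d ε), ∀ e ∈ S, c e ≤ m S)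
    (hm0 : ∀ S ∈ B.powersetCard (sampleSize B d ε), 0 ≤ m S) :
    (1 - ε) / d * topSum B d c ≤ ∑ S, (sampleLaw B d ε S).toReal * m S := by
  obtain ⟨T, hT, hTd, htop⟩ := exists_topSum_eq B d c
  -- The maximizer may have fewer than `d` elements; padding it to exactly `d` cannot lower the sum
  -- of the nonnegative values.
  obtain ⟨A, hTA, hA, hAd⟩ := Finset.exists_subsuperset_card_eq hT hTd hB
  have hsum : topSum B d c ≤ ∑ a ∈ A, c a :=
    htop.trans_le (Finset.sum_le_sum_of_subset_of_nonneg hTA fun e _ _ => hc e)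
  have hA0 : 0 ≤ ∑ a ∈ A, c a := Finset.sum_nonneg fun e _ => hc e
  set P := B.powersetCard (sampleSize B d ε) with hP
  have hcard : (0 : ℝ) < P.card := by
    exact_mod_cast (Finset.powersetCard_nonempty.2 (sampleSize_le_card B d ε)).card_pos
  have hd' : (0 : ℝ) < d := by exact_mod_cast hd
  have h1 := card_disjoint_le (ε := ε) h0 hd hA hAd
  have h2 := sum_meeting_le hA _ hm hm0
  rw [hAd] at h2
  rw [← hP] at h1 h2
  have h3 : ((P.filter fun S => Disjoint S A).card : ℝ) +
      ((P.filter fun S => ¬ Disjoint S A).card : ℝ) = P.card := by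
    exact_mod_cast Finset.card_filter_add_card_filter_not (s := P) fun S => Disjoint S A
  rw [sum_sampleLaw, ← hP]
  have hpos : 0 ≤ ∑ S ∈ P, m S := Finset.sum_nonneg hm0
  have key : (1 - ε) * P.card * topSum B d c ≤ d * ∑ S ∈ P, m S := by
    have hge : (1 - ε) * P.card ≤ ((P.filter fun S => ¬ Disjoint S A).card : ℝ) := by linarith
    rcases le_total 0 (1 - ε) with hε | hε
    · calc (1 - ε) * P.card * topSum B d c ≤ (1 - ε) * P.card * ∑ a ∈ A, c a := by gcongr
        _ ≤ ((P.filter fun S => ¬ Disjoint S A).card : ℝ) * ∑ a ∈ A, c a := by gcongr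
        _ ≤ _ := h2
    · exact (mul_nonpos_of_nonpos_of_nonneg (mul_nonpos_of_nonpos_of_nonneg hε hcard.le)
        (topSum_nonneg _ _ _)).trans (by positivity)
  rw [inv_mul_eq_div, le_div_iff₀ hcard, div_mul_eq_mul_div, div_mul_eq_mul_div, div_le_iff₀ hd']
  linarith

end Sampling

/-! ### Consequences of submodularity and monotonicity. -/

section Marginals

open PartialRealization

variable {E : Type u} {O : Type v} [Fintype E] [DecidableEq E]
  {p : PMF (E → O)} {f : Finset E → (E → O) → ℝ}

theorem AdaptiveMonotone.consSum_nonneg (hmono : AdaptiveMonotone p f)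
    (ψ : PartialRealization E O) (e : E) :
    0 ≤ consSum p ψ fun φ => f (ψ.dom ∪ {e}) φ - f ψ.dom φ := by
  rcases (prob_nonneg (p := p) ψ).eq_or_lt with h | h
  · rw [consSum_eq_zero h.symm]
  · rw [consSum_eq_prob_mul_condExpect]
    exact mul_nonneg h.le (hmono ψ h e)

/-- Selecting `e` after the run of `π` does not lose anything in expectation, and it turns any
outcome of `π`, a subset of `{e}`, into `{e}`. -/
theorem AdaptiveMonotone.policyMarginal_le (hmono : AdaptiveMonotone p f)
    (hs : ∀ S, Summable fun φ => (p φ).toReal * f S φ) {ψ : PartialRealization E O}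
    (hψ : 0 < prob p ψ) {e : E} {π : Policy E O} (hπ : π ∈ policiesFrom O {e} 1) :
    policyMarginal p f π ψ ≤ marginal p f {e} ψ := by
  refine div_le_div_of_nonneg_right (sub_nonneg.1 ?_) hψ.le
  have h := consSum_expect_nonneg (K := fun S φ => f (S ∪ {e}) φ - f S φ)
    (fun S => summable_sub (hs _) (hs _)) (fun ψ => hmono.consSum_nonneg ψ e) π ψ
  refine h.trans_eq ?_
  change _ = consSum p ψ _ - consSum p ψ _
  rw [← consSum_sub (summable_sub (hs _) (hs _))
    (summable_expect (fun _ => π) (K := fun S φ => f (ψ.dom ∪ S) φ - f ψ.dom φ)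
      fun S => summable_sub (hs _) (hs _))]
  refine consSum_congr fun φ _ => ?_
  have h1 : (π.expect φ fun S => f (ψ.dom ∪ S ∪ {e}) φ) = f (ψ.dom ∪ {e}) φ := by
    have heq : ∀ S ∈ (π.selected φ).support, f (ψ.dom ∪ S ∪ {e}) φ = f (ψ.dom ∪ {e}) φ := by
      intro S hS
      rw [Finset.union_assoc, Finset.union_eq_right.2 (hπ φ S hS).1]
    rw [← π.expect_const φ (f (ψ.dom ∪ {e}) φ)]
    exact le_antisymm (π.expect_mono φ fun S hS => (heq S hS).le)
      (π.expect_mono φ fun S hS => (heq S hS).ge)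
  simp_rw [Policy.expect_sub, Policy.expect_const]
  rw [h1]
  ring

/-- Full adaptive submodularity, applied to the policies that select at most one given item,
yields adaptive submodularity. -/
theorem FullyAdaptiveSubmodular.marginal_anti (hsub : FullyAdaptiveSubmodular p f)
    (hmono : AdaptiveMonotone p f) (hs : ∀ S, Summable fun φ => (p φ).toReal * f S φ)
    {ψ ψ' : PartialRealization E O} (h : ψ.IsSub ψ') (hψ' : 0 < prob p ψ') (e : E) :
    marginal p f {e} ψ' ≤ marginal p f {e} ψ := by
  have hψ : 0 < prob p ψ := hψ'.trans_le (prob_anti h)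
  have hmem : (Policy.select e fun _ => Policy.halt : Policy E O) ∈ policiesFrom O {e} 1 := by
    intro φ S hS
    simp only [Policy.selected, PMF.pure_map, PMF.support_pure, Set.mem_singleton_iff] at hS
    simp [hS]
  have heq : policyMarginal p f (.select e fun _ => .halt) ψ' = marginal p f {e} ψ' := by
    simp [policyMarginal, marginal, Policy.expect_select, Policy.expect_halt]
  calc marginal p f {e} ψ' = policyMarginal p f (.select e fun _ => .halt) ψ' := heq.symm
    _ ≤ sSup ((fun π => policyMarginal p f π ψ') '' policiesFrom O {e} 1) := by
      -- A real `sSup` is 0 for a set that is not bounded above, so an explicit upper bound is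
      -- needed here.
      refine le_csSup ⟨marginal p f {e} ψ', ?_⟩ ⟨_, hmem, rfl⟩
      rintro _ ⟨π, hπ, rfl⟩
      exact hmono.policyMarginal_le hs hψ' hπ
    _ ≤ sSup ((fun π => policyMarginal p f π ψ) '' policiesFrom O {e} 1) :=
      hsub ψ ψ' h hψ' {e} 1 le_rfl (by simp)
    _ ≤ marginal p f {e} ψ := by
      refine csSup_le ⟨_, _, hmem, rfl⟩ ?_
      rintro _ ⟨π, hπ, rfl⟩
      exact hmono.policyMarginal_le hs hψ hπ

/-- The largest sum of conditional expected marginal utilities of at most `d` items of `B`. -/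
noncomputable def topMarginal (p : PMF (E → O)) (f : Finset E → (E → O) → ℝ) (B : Finset E) (d : ℕ)
    (ψ : PartialRealization E O) : ℝ :=
  topSum B d fun e => marginal p f {e} ψ

theorem topMarginal_nonneg (B : Finset E) (d : ℕ) (ψ : PartialRealization E O) :
    0 ≤ topMarginal p f B d ψ := topSum_nonneg _ _ _

theorem topMarginal_anti (hsub : FullyAdaptiveSubmodular p f) (hmono : AdaptiveMonotone p f)
    (hs : ∀ S, Summable fun φ => (p φ).toReal * f S φ) (B : Finset E) (d : ℕ)
    {ψ ψ' : PartialRealization E O} (h : ψ.IsSub ψ') (hψ' : 0 < prob p ψ') :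
    topMarginal p f B d ψ' ≤ topMarginal p f B d ψ :=
  topSum_mono B d fun e => hsub.marginal_anti hmono hs h hψ' e

theorem summable_topMarginal (hsub : FullyAdaptiveSubmodular p f) (hmono : AdaptiveMonotone p f)
    (hs : ∀ S, Summable fun φ => (p φ).toReal * f S φ) (B : Finset E) (d : ℕ) (S : Finset E) :
    Summable fun φ => (p φ).toReal * topMarginal p f B d (restrict φ S) := by
  -- By antitonicity, the value with nothing observed bounds all others outside null realizations.
  refine summable_of_bounded (topMarginal p f B d fun _ => none) fun φ hφ => ?_
  rw [abs_of_nonneg (topMarginal_nonneg _ _ _)]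
  refine topMarginal_anti hsub hmono hs B d (fun e o h => ?_)
    (prob_pos (mem_consistent_restrict φ S) hφ)
  simp at h

/-- The marginal utility of a feasible policy is at most the sum over the blocks of the largest
sums of marginal utilities. -/
theorem consSum_expect_le_sum_topMarginal (hsub : FullyAdaptiveSubmodular p f)
    (hmono : AdaptiveMonotone p f) (hs : ∀ S, Summable fun φ => (p φ).toReal * f S φ)
    {b : ℕ} {B : Fin b → Finset E} {d : Fin b → ℕ} (hB : ∀ i j, i ≠ j → Disjoint (B i) (B j))
    (hcover : ∀ e, ∃ i, e ∈ B i) {π : Policy E O} (hπ : π ∈ feasiblePolicies O B d)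
    (ψ : PartialRealization E O) :
    (consSum p ψ fun φ => π.expect φ fun S => f (ψ.dom ∪ S) φ - f ψ.dom φ) ≤
      consSum p ψ fun _ => ∑ i, topMarginal p f (B i) (d i) ψ := by
  rcases (prob_nonneg (p := p) ψ).eq_or_lt with h | h
  · rw [consSum_eq_zero h.symm, consSum_eq_zero h.symm]
  -- The marginals are frozen at ψ. Later true marginals are no larger, so the total of `c` minus
  -- the utility has nonnegative drift along any run from ψ.
  let c : E → ℝ := fun e => marginal p f {e} ψ
  have hc : ∀ e, 0 ≤ c e := fun e => hmono ψ h e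
  have hdrift : 0 ≤ consSum p ψ fun φ => π.expect φ fun S =>
      ((∑ e ∈ ψ.dom ∪ S, c e) - f (ψ.dom ∪ S) φ) - ((∑ e ∈ ψ.dom, c e) - f ψ.dom φ) := by
    refine consSum_expect_sub_nonneg (K := fun S φ => (∑ e ∈ S, c e) - f S φ)
      (fun S => summable_sub (summable_const _) (hs S)) ψ (fun ψ' hψ' e he => ?_) π ψ
      fun _ _ h => h
    have heq : (consSum p ψ' fun φ => ((∑ e ∈ insert e ψ'.dom, c e) - f (insert e ψ'.dom) φ) -
        ((∑ e ∈ ψ'.dom, c e) - f ψ'.dom φ)) =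
        (consSum p ψ' fun _ => c e) -
          consSum p ψ' fun φ => f (ψ'.dom ∪ {e}) φ - f ψ'.dom φ := by
      rw [← consSum_sub (summable_const _) (summable_sub (hs _) (hs _))]
      refine consSum_congr fun φ _ => ?_
      rw [Finset.sum_insert he, Finset.union_singleton]
      ring
    rw [heq, consSum_const, consSum_eq_prob_mul_condExpect, ← mul_sub]
    rcases (prob_nonneg (p := p) ψ').eq_or_lt with h' | h'
    · rw [← h', zero_mul]
    · exact mul_nonneg h'.le (sub_nonneg.2 (hsub.marginal_anti hmono hs hψ' h' e))
  have hbound : ∀ φ, ∀ S ∈ (π.selected φ).support,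
      (∑ e ∈ ψ.dom ∪ S, c e) - ∑ e ∈ ψ.dom, c e ≤ ∑ i, topMarginal p f (B i) (d i) ψ := by
    intro φ S hS
    -- Items of `S` already observed in ψ count only on the right.
    have h1 : (∑ e ∈ ψ.dom ∪ S, c e) - ∑ e ∈ ψ.dom, c e ≤ ∑ e ∈ S, c e := by
      have := Finset.sum_union_inter (s₁ := ψ.dom) (s₂ := S) (f := c)
      have h2 : 0 ≤ ∑ e ∈ ψ.dom ∩ S, c e := Finset.sum_nonneg fun e _ => hc e
      linarith
    have h2 : S = Finset.univ.biUnion fun i => S ∩ B i := by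
      ext e
      obtain ⟨i, hi⟩ := hcover e
      simp only [Finset.mem_biUnion, Finset.mem_univ, true_and, Finset.mem_inter]
      exact ⟨fun he => ⟨i, he, hi⟩, fun ⟨_, he, _⟩ => he⟩
    refine h1.trans ?_
    rw [h2, Finset.sum_biUnion fun i _ j _ hij =>
      (hB i j hij).mono Finset.inter_subset_right Finset.inter_subset_right]
    exact Finset.sum_le_sum fun i _ =>
      sum_le_topSum c Finset.inter_subset_right (hπ φ S hS i)
  have hsexp : Summable fun φ => (p φ).toReal *
      π.expect φ fun S => f (ψ.dom ∪ S) φ - f ψ.dom φ :=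
    summable_expect (fun _ => π) (K := fun S φ => f (ψ.dom ∪ S) φ - f ψ.dom φ)
      fun S => summable_sub (hs _) (hs _)
  have hsK : Summable fun φ => (p φ).toReal * π.expect φ fun S =>
      ((∑ e ∈ ψ.dom ∪ S, c e) - f (ψ.dom ∪ S) φ) - ((∑ e ∈ ψ.dom, c e) - f ψ.dom φ) :=
    summable_expect (fun _ => π) (K := fun S φ =>
      ((∑ e ∈ ψ.dom ∪ S, c e) - f (ψ.dom ∪ S) φ) - ((∑ e ∈ ψ.dom, c e) - f ψ.dom φ))
      fun S => summable_sub (summable_sub (summable_const _) (hs _))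
        (summable_sub (summable_const _) (hs _))
  refine (le_add_of_nonneg_left hdrift).trans ?_
  rw [← consSum_add hsK hsexp]
  refine consSum_mono (summable_add hsK hsexp) (summable_const _) fun φ _ _ => ?_
  rw [← Policy.expect_add, ← π.expect_const φ (∑ i, topMarginal p f (B i) (d i) ψ)]
  refine π.expect_mono φ fun S hS => ?_
  have := hbound φ S hS
  linarith

/-- The utility of the union of two independent runs is at least that of one of them. -/
theorem favg_le_tsum_union (hmono : AdaptiveMonotone p f)
    (hs : ∀ S, Summable fun φ => (p φ).toReal * f S φ) (π π' : Policy E O) :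
    favg p f π' ≤ ∑' φ, (p φ).toReal * π.expect φ fun S => π'.expect φ fun T => f (S ∪ T) φ := by
  -- Started on top of any ψ, the policy `π` has nonnegative mean gain. This is then applied at the
  -- random ψ where `π'` ends; the two independent sources of randomness commute.
  have hstep (ψ : PartialRealization E O) :
      0 ≤ consSum p ψ fun φ => π.expect φ fun S => f (ψ.dom ∪ S) φ - f ψ.dom φ := by
    refine consSum_expect_sub_nonneg hs ψ (fun ψ' _ e _ => ?_) π ψ fun _ _ h => h
    simpa [Finset.union_singleton] using hmono.consSum_nonneg ψ' e
  have hsum (S : Finset E) : Summable fun φ => (p φ).toReal *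
      π.expect φ fun T => f (S ∪ T) φ - f S φ :=
    summable_expect (fun _ => π) (K := fun T φ => f (S ∪ T) φ - f S φ)
      fun T => summable_sub (hs _) (hs _)
  have h := consSum_expect_nonneg (K := fun S φ => π.expect φ fun T => f (S ∪ T) φ - f S φ)
    hsum hstep π' fun _ => none
  have hs1 : Summable fun φ => (p φ).toReal *
      π.expect φ fun S => π'.expect φ fun T => f (S ∪ T) φ :=
    summable_expect (fun _ => π) (K := fun S φ => π'.expect φ fun T => f (S ∪ T) φ)
      fun S => summable_expect (fun _ => π') fun T => hs _
  have hs2 : Summable fun φ => (p φ).toReal * π'.expect φ fun T => f T φ :=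
    summable_expect (fun _ => π') hs
  rw [← sub_nonneg, favg, ← consSum_empty, ← consSum_empty, ← consSum_sub hs1 hs2]
  refine h.trans_eq (consSum_congr fun φ _ => ?_)
  simp only [dom_empty, Finset.empty_union]
  simp_rw [Policy.expect_sub, Policy.expect_const]
  rw [π.expect_expect_comm]
  simp_rw [Finset.union_comm]

end Marginals

/-! ### Greedy as a policy. -/

section GreedyAnalysis

open PartialRealization

variable {E : Type u} {O : Type v} [DecidableEq E]

/-- Queries leave no node in the policy; only the recorded answers remain, with `g` as default for
the items not queried. -/
theorem toPolicy_queryAll (oracle : E → PartialRealization E O → ℝ) (ψ : PartialRealization E O)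
    (next : (E → ℝ) → Algorithm E O) (l : List E) (g : E → ℝ) :
    (Algorithm.queryAll ψ next l g).toPolicy oracle =
      (next fun e => if e ∈ l then oracle e ψ else g e).toPolicy oracle := by
  induction l generalizing g with
  | nil => simp [Algorithm.queryAll]
  | cons a l ih =>
    rw [Algorithm.queryAll, Algorithm.toPolicy, ih]
    congr 2
    funext e
    by_cases h : e = a
    · subst h; simp
    · simp [h]

/-- The item selected by greedy from a nonempty sample when `oracle` answers the queries. -/
def greedyPick (oracle : E → PartialRealization E O → ℝ) (rule : ArgmaxRule E O)
    (ψ : PartialRealization E O) (S : Finset E) (hS : S.Nonempty) : E :=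
  rule.pick ψ S hS fun e => if e ∈ S then oracle e ψ else 0

theorem greedyPick_mem (oracle : E → PartialRealization E O → ℝ) (rule : ArgmaxRule E O)
    (ψ : PartialRealization E O) (S : Finset E) (hS : S.Nonempty) :
    greedyPick oracle rule ψ S hS ∈ S := rule.pick_mem _ _ _ _

theorem le_greedyPick (oracle : E → PartialRealization E O → ℝ) (rule : ArgmaxRule E O)
    (ψ : PartialRealization E O) (S : Finset E) (hS : S.Nonempty) {e : E} (he : e ∈ S) :
    oracle e ψ ≤ oracle (greedyPick oracle rule ψ S hS) ψ := by
  have h := rule.le_pick ψ S hS (fun e => if e ∈ S then oracle e ψ else 0) e he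
  rwa [if_pos he, if_pos (rule.pick_mem ψ S hS _)] at h

theorem toPolicy_stochasticGreedy_succ (oracle : E → PartialRealization E O → ℝ)
    (rule : ArgmaxRule E O) (ε : ℝ) (B : Finset E) (d : ℕ)
    (next : PartialRealization E O → Algorithm E O) (r : ℕ) (ψ : PartialRealization E O) :
    (stochasticGreedy rule ε B d next (r + 1) ψ).toPolicy oracle =
      .sample (sampleLaw B d ε) fun S =>
        if hS : S.Nonempty then .select (greedyPick oracle rule ψ S hS) fun o =>
          (stochasticGreedy rule ε B d next r
            (Function.update ψ (greedyPick oracle rule ψ S hS) (some o))).toPolicy oracle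
        else (stochasticGreedy rule ε B d next r ψ).toPolicy oracle := by
  rw [stochasticGreedy, Algorithm.toPolicy]
  congr 1
  funext S
  split_ifs with hS
  · simp_rw [toPolicy_queryAll, Algorithm.toPolicy, Finset.mem_toList]
    rfl
  · rfl

/-! ### Feasibility. -/

theorem card_inter_le_stochasticGreedy (oracle : E → PartialRealization E O → ℝ)
    (rule : ArgmaxRule E O) (ε : ℝ) (B : Finset E) (d : ℕ)
    (next : PartialRealization E O → Algorithm E O) (C : Finset E) (N : ℕ) (φ : E → O)
    (hnext : ∀ ψ, ∀ S ∈ (((next ψ).toPolicy oracle).selected φ).support, (S ∩ C).card ≤ N)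
    (r : ℕ) : ∀ ψ, ∀ S ∈ (((stochasticGreedy rule ε B d next r ψ).toPolicy oracle).selected
      φ).support, (S ∩ C).card ≤ (if Disjoint B C then 0 else r) + N := by
  induction r with
  | zero =>
    intro ψ S hS
    simpa using hnext ψ S hS
  | succ r ih =>
    intro ψ S hS
    rw [toPolicy_stochasticGreedy_succ, Policy.selected, PMF.mem_support_bind_iff] at hS
    obtain ⟨T, hT, hS⟩ := hS
    have hTB : T ⊆ B := by
      rw [sampleLaw, PMF.support_uniformOfFinset] at hT
      exact (Finset.mem_powersetCard.1 hT).1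
    split_ifs at hS with hne
    · rw [Policy.selected, PMF.mem_support_map_iff] at hS
      obtain ⟨S', hS', rfl⟩ := hS
      have h := ih _ S' hS'
      have hmem := hTB (greedyPick_mem oracle rule ψ T hne)
      -- The selected item lies in `B`, so it can count towards `C` only if the two sets meet.
      by_cases hC : Disjoint B C
      · rw [Finset.insert_inter_of_notMem (Finset.disjoint_left.1 hC hmem)]
        simpa [hC] using h
      · have h' : (insert (greedyPick oracle rule ψ T hne) S' ∩ C).card ≤ (S' ∩ C).card + 1 := by
          refine (Finset.card_le_card ?_).trans
            (Finset.card_insert_le (greedyPick oracle rule ψ T hne) (S' ∩ C))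
          intro x
          simp only [Finset.mem_inter, Finset.mem_insert]
          tauto
        simp only [hC, if_false] at h ⊢
        omega
    · have h := ih ψ S hS
      split_ifs at h ⊢ <;> omega

theorem card_inter_le_blockwiseGreedy (oracle : E → PartialRealization E O → ℝ)
    (rule : ArgmaxRule E O) (ε : ℝ) (C : Finset E) (φ : E → O) (L : List (Finset E × ℕ)) :
    ∀ ψ, ∀ S ∈ (((blockwiseGreedy rule ε L ψ).toPolicy oracle).selected φ).support,
      (S ∩ C).card ≤ (L.map fun x => if Disjoint x.1 C then 0 else x.2).sum := by
  induction L with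
  | nil =>
    intro ψ S hS
    simp only [blockwiseGreedy, Algorithm.toPolicy, Policy.selected, PMF.support_pure,
      Set.mem_singleton_iff] at hS
    simp [hS]
  | cons x L ih =>
    intro ψ S hS
    obtain ⟨B, d⟩ := x
    rw [List.map_cons, List.sum_cons]
    exact card_inter_le_stochasticGreedy oracle rule ε B d _ C _ φ ih d ψ S hS

theorem gasgPolicy_mem_feasiblePolicies [Fintype E] (p : PMF (E → O))
    (f : Finset E → (E → O) → ℝ) (rule : ArgmaxRule E O) (ε : ℝ) {b : ℕ} {B : Fin b → Finset E}
    (d : Fin b → ℕ) (hB : ∀ i j, i ≠ j → Disjoint (B i) (B j)) :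
    gasgPolicy p f rule ε B d ∈ feasiblePolicies O B d := by
  intro φ S hS i
  refine (card_inter_le_blockwiseGreedy _ rule ε (B i) φ _ _ S hS).trans ?_
  rw [List.map_ofFn, List.sum_ofFn, Finset.sum_eq_single i]
  -- An empty block is disjoint from itself, so both branches occur.
  · dsimp only [Function.comp_apply]
    split_ifs <;> omega
  · intro j _ hj
    simp [hB j i hj]
  · simp

/-! ### Number of oracle queries. -/

theorem queryCount_queryAll_le (ψ : PartialRealization E O)
    {next : (E → ℝ) → Algorithm E O} {N : ℕ∞} (h : ∀ g, (next g).queryCount ≤ N) (l : List E)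
    (g : E → ℝ) : (Algorithm.queryAll ψ next l g).queryCount ≤ l.length + N := by
  induction l generalizing g with
  | nil => simpa [Algorithm.queryAll] using h g
  | cons a l ih =>
    rw [Algorithm.queryAll, Algorithm.queryCount, List.length_cons]
    push_cast
    rw [add_comm (l.length : ℕ∞) 1, add_assoc]
    gcongr
    exact iSup_le fun r => ih _

theorem queryCount_stochasticGreedy_le (rule : ArgmaxRule E O) (ε : ℝ) (B : Finset E) (d : ℕ)
    {next : PartialRealization E O → Algorithm E O} {N : ℕ∞}
    (h : ∀ ψ, (next ψ).queryCount ≤ N) (r : ℕ) : ∀ ψ,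
      (stochasticGreedy rule ε B d next r ψ).queryCount ≤ (r * sampleSize B d ε : ℕ) + N := by
  induction r with
  | zero => intro ψ; simpa [stochasticGreedy] using h ψ
  | succ r ih =>
    intro ψ
    rw [stochasticGreedy, Algorithm.queryCount]
    refine iSup₂_le fun S hS => ?_
    rw [sampleLaw, PMF.support_uniformOfFinset] at hS
    have hcard : S.card = sampleSize B d ε := (Finset.mem_powersetCard.1 hS).2
    have heq : ((((r + 1) * sampleSize B d ε : ℕ) : ℕ∞) + N) =
        (sampleSize B d ε : ℕ∞) + ((r * sampleSize B d ε : ℕ) + N) := by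
      push_cast; ring
    rw [heq]
    split_ifs with hne
    · refine (queryCount_queryAll_le ψ (N := (r * sampleSize B d ε : ℕ) + N) (fun g => ?_)
        S.toList _).trans ?_
      · rw [Algorithm.queryCount]
        exact iSup_le fun o => ih _
      · rw [Finset.length_toList, hcard]
    · exact (ih ψ).trans le_add_self

theorem queryCount_blockwiseGreedy_le (rule : ArgmaxRule E O) (ε : ℝ)
    (L : List (Finset E × ℕ)) : ∀ ψ, (blockwiseGreedy rule ε L ψ).queryCount ≤
      ((L.map fun x => x.2 * sampleSize x.1 x.2 ε).sum : ℕ) := by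
  induction L with
  | nil => intro ψ; simp [blockwiseGreedy, Algorithm.queryCount]
  | cons x L ih =>
    intro ψ
    obtain ⟨B, d⟩ := x
    rw [List.map_cons, List.sum_cons, Nat.cast_add]
    exact queryCount_stochasticGreedy_le rule ε B d ih d ψ

omit [DecidableEq E] in
theorem mul_sampleSize_le {B : Finset E} {d : ℕ} {ε : ℝ} (h0 : 0 < ε) (h1 : ε < 1)
    (hd : d ≤ B.card) : ((d * sampleSize B d ε : ℕ) : ℝ) ≤ B.card * (Real.log (1 / ε) + 1) := by
  have hL := log_one_div_pos h0 h1
  rcases Nat.eq_zero_or_pos d with rfl | hpos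
  · simp only [zero_mul, Nat.cast_zero]; positivity
  have hd' : (0 : ℝ) < d := by exact_mod_cast hpos
  have hdB : (d : ℝ) ≤ B.card := by exact_mod_cast hd
  have hs : (sampleSize B d ε : ℝ) ≤ (B.card : ℝ) / d * Real.log (1 / ε) + 1 :=
    (Nat.cast_le.2 (min_le_left _ _)).trans (Nat.ceil_lt_add_one (by positivity)).le
  calc ((d * sampleSize B d ε : ℕ) : ℝ) = d * sampleSize B d ε := by push_cast; rfl
    _ ≤ d * ((B.card : ℝ) / d * Real.log (1 / ε) + 1) := by gcongr
    _ = B.card * Real.log (1 / ε) + d := by field_simp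
    _ ≤ _ := by linarith

theorem queryCount_generalizedStochasticGreedy_le [Fintype E] {ε₀ ε : ℝ} (hε₀ : ε₀ < 1)
    (h0 : 0 < ε) (hε : ε ≤ ε₀) (rule : ArgmaxRule E O) {b : ℕ} {B : Fin b → Finset E}
    {d : Fin b → ℕ} (hB : ∀ i j, i ≠ j → Disjoint (B i) (B j)) (hd : ∀ i, d i ≤ (B i).card) :
    ((generalizedStochasticGreedy rule ε B d).queryCount : ENNReal) ≤
      ENNReal.ofReal ((1 + 1 / Real.log (1 / ε₀)) * (Fintype.card E : ℝ) * Real.log (1 / ε)) := by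
  have hlog₀ := log_one_div_pos (h0.trans_le hε) hε₀
  have hlog : Real.log (1 / ε₀) ≤ Real.log (1 / ε) :=
    Real.log_le_log (one_div_pos.2 (h0.trans_le hε)) (one_div_le_one_div_of_le h0 hε)
  have h := queryCount_blockwiseGreedy_le rule ε (List.ofFn fun i => (B i, d i))
    (fun _ => none : PartialRealization E O)
  rw [List.map_ofFn, List.sum_ofFn] at h
  refine (ENat.toENNReal_le.2 h).trans ?_
  rw [ENat.toENNReal_coe, ← ENNReal.ofReal_natCast]
  refine ENNReal.ofReal_le_ofReal ?_
  have hcard : ∑ i, ((B i).card : ℝ) ≤ Fintype.card E := by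
    have := Finset.card_le_univ (Finset.univ.biUnion B)
    rw [Finset.card_biUnion fun i _ j _ hij => hB i j hij] at this
    exact_mod_cast this
  -- Rounding up costs at most one query per round, so at most n in all. This term is absorbed into
  -- n log (1 / ε) because ε stays below ε₀ < 1.
  have h1 : 1 ≤ 1 / Real.log (1 / ε₀) * Real.log (1 / ε) := by
    rw [one_div_mul_eq_div, one_le_div hlog₀]; exact hlog
  push_cast
  calc ∑ i, (((fun x : Finset E × ℕ => x.2 * sampleSize x.1 x.2 ε) ∘ fun i => (B i, d i)) i : ℝ)
      ≤ ∑ i, ((B i).card : ℝ) * (Real.log (1 / ε) + 1) :=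
        Finset.sum_le_sum fun i _ => mul_sampleSize_le h0 (hε.trans_lt hε₀) (hd i)
    _ = (∑ i, ((B i).card : ℝ)) * (Real.log (1 / ε) + 1) := by rw [Finset.sum_mul]
    _ ≤ (Fintype.card E : ℝ) * (Real.log (1 / ε) + 1) := by
        have := hlog₀.trans_le hlog
        gcongr
    _ ≤ (Fintype.card E : ℝ) * (Real.log (1 / ε) + 1 / Real.log (1 / ε₀) * Real.log (1 / ε)) := by
        gcongr
    _ = _ := by ring

/-! ### The approximation ratio. -/

variable [Fintype E] {p : PMF (E → O)} {f : Finset E → (E → O) → ℝ}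

/-- One block of stochastic greedy gains at least `(1 - ε) r / d` times the largest sum of
marginal utilities that is left at the end. -/
theorem stochasticGreedy_gain (hsub : FullyAdaptiveSubmodular p f) (hmono : AdaptiveMonotone p f)
    (hs : ∀ S, Summable fun φ => (p φ).toReal * f S φ) (rule : ArgmaxRule E O) {ε : ℝ}
    (h0 : 0 < ε) (h1 : ε < 1) {B : Finset E} {d : ℕ} (hd : 0 < d) (hB : d ≤ B.card)
    {next : PartialRealization E O → Algorithm E O} {R : PartialRealization E O → ℝ}
    (hR : ∀ S, Summable fun φ => (p φ).toReal * R (restrict φ S))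
    (hnext : ∀ ψ : PartialRealization E O, 0 ≤ consSum p ψ fun φ =>
      ((next ψ).toPolicy fun e ψ => marginal p f {e} ψ).expect φ fun S =>
        f (ψ.dom ∪ S) φ - f ψ.dom φ - R (restrict φ (ψ.dom ∪ S))) (r : ℕ) :
    ∀ ψ : PartialRealization E O, 0 ≤ consSum p ψ fun φ =>
      ((stochasticGreedy rule ε B d next r ψ).toPolicy fun e ψ => marginal p f {e} ψ).expect φ
        fun S => f (ψ.dom ∪ S) φ - f ψ.dom φ - (R (restrict φ (ψ.dom ∪ S)) +
          r * ((1 - ε) / d) * topMarginal p f B d (restrict φ (ψ.dom ∪ S))) := by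
  have hτ := summable_topMarginal hsub hmono hs B d
  have hX (r : ℕ) (D S : Finset E) : Summable fun φ => (p φ).toReal * (f S φ - f D φ -
      (R (restrict φ S) + r * ((1 - ε) / d) * topMarginal p f B d (restrict φ S))) :=
    summable_sub (summable_sub (hs _) (hs _))
      (summable_add (hR _) (summable_const_mul _ (hτ _)))
  have hβ : 0 ≤ (1 - ε) / d := div_nonneg (by linarith) (Nat.cast_nonneg d)
  induction r with
  | zero =>
    intro ψ
    simpa [stochasticGreedy] using hnext ψ
  | succ r ih =>
    intro ψ
    rcases (prob_nonneg (p := p) ψ).eq_or_lt with hψ | hψ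
    · rw [consSum_eq_zero hψ.symm]
    rw [toPolicy_stochasticGreedy_succ]
    simp_rw [Policy.expect_sample]
    rw [consSum_sum]
    swap
    · exact fun S => summable_const_mul _ (summable_expect _ fun T => hX _ _ _)
    simp_rw [consSum_const_mul]
    let m : Finset E → ℝ := fun S =>
      if hS : S.Nonempty then marginal p f {greedyPick (fun e ψ => marginal p f {e} ψ) rule ψ S hS} ψ
      else 0
    -- `m S` is the expected gain of this round when the sample is `S`.
    have hm : (1 - ε) / d * topMarginal p f B d ψ ≤
        ∑ S, (sampleLaw B d ε S).toReal * m S := by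
      refine le_sum_sampleLaw h0 hd hB (fun e => hmono ψ hψ e) (fun S _ e he => ?_) fun S _ => ?_
      · simp only [m, dif_pos (show S.Nonempty from ⟨e, he⟩)]
        exact le_greedyPick (fun e ψ => marginal p f {e} ψ) rule ψ S _ he
      · simp only [m]
        split_ifs
        · exact hmono ψ hψ _
        · exact le_rfl
    have hlaw : ∑ S, (sampleLaw B d ε S).toReal = 1 := by
      rw [← ENNReal.toReal_sum fun S _ => PMF.apply_ne_top _ _,
        ← tsum_fintype (L := .unconditional _), PMF.tsum_coe, ENNReal.toReal_one]
    have hfinal : 0 ≤ ∑ S, (sampleLaw B d ε S).toReal *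
        (prob p ψ * (m S - (1 - ε) / d * topMarginal p f B d ψ)) := by
      have heq : ∑ S, (sampleLaw B d ε S).toReal *
          (prob p ψ * (m S - (1 - ε) / d * topMarginal p f B d ψ)) =
          prob p ψ * (∑ S, (sampleLaw B d ε S).toReal * m S -
            (∑ S, (sampleLaw B d ε S).toReal) * ((1 - ε) / d * topMarginal p f B d ψ)) := by
        rw [Finset.sum_mul, ← Finset.sum_sub_distrib, Finset.mul_sum]
        exact Finset.sum_congr rfl fun S _ => by ring
      rw [heq, hlaw, one_mul]
      exact mul_nonneg hψ.le (sub_nonneg.2 hm)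
    refine hfinal.trans (Finset.sum_le_sum fun S _ => ?_)
    by_cases hS : S ∈ B.powersetCard (sampleSize B d ε)
    swap
    · rw [sampleLaw, PMF.uniformOfFinset_apply_of_notMem _ hS]
      simp
    refine mul_le_mul_of_nonneg_left ?_ ENNReal.toReal_nonneg
    -- Possible samples are nonempty, so the branch of the algorithm that selects nothing has
    -- probability zero.
    have hne : S.Nonempty := by
      rw [← Finset.card_pos, (Finset.mem_powersetCard.1 hS).2]
      exact sampleSize_pos h0 h1 hd hB
    simp only [m, dif_pos hne]
    set e := greedyPick (fun e ψ => marginal p f {e} ψ) rule ψ S hne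
    simp_rw [Policy.expect_select]
    let Q : O → Policy E O := fun o => (stochasticGreedy rule ε B d next r
      (Function.update ψ e (some o))).toPolicy fun e ψ => marginal p f {e} ψ
    let X : ℕ → Finset E → (E → O) → ℝ := fun r S φ => f (ψ.dom ∪ insert e S) φ - f ψ.dom φ -
      (R (restrict φ (ψ.dom ∪ insert e S)) +
        r * ((1 - ε) / d) * topMarginal p f B d (restrict φ (ψ.dom ∪ insert e S)))
    have hsQ : Summable fun φ => (p φ).toReal * (Q (φ e)).expect φ fun S => X (r + 1) S φ :=
      summable_expect (fun φ => Q (φ e)) fun S => hX (r + 1) ψ.dom _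
    have hsgain : Summable fun φ => (p φ).toReal *
        (f (ψ.dom ∪ {e}) φ - f ψ.dom φ - (1 - ε) / d * topMarginal p f B d ψ) :=
      summable_sub (summable_sub (hs _) (hs _)) (summable_const _)
    have hgain : (consSum p ψ fun φ => f (ψ.dom ∪ {e}) φ - f ψ.dom φ -
        (1 - ε) / d * topMarginal p f B d ψ) =
        prob p ψ * (marginal p f {e} ψ - (1 - ε) / d * topMarginal p f B d ψ) := by
      rw [consSum_sub (summable_sub (hs _) (hs _)) (summable_const _), consSum_const,
        consSum_eq_prob_mul_condExpect, mul_sub]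
      rfl
    rw [← hgain]
    change _ ≤ consSum p ψ fun φ => (Q (φ e)).expect φ fun S => X (r + 1 : ℕ) S φ
    -- Subtract the surplus of this round over (1 - ε) / d times the current `topMarginal`; after
    -- conditioning on the state of `e`, the remaining `r` rounds are covered by induction.
    rw [← sub_nonneg, ← consSum_sub hsQ hsgain]
    refine consSum_nonneg_of_update e (summable_sub hsQ hsgain) fun o ho => ?_
    refine (ih (Function.update ψ e (some o))).trans ?_
    refine consSum_mono (summable_expect (fun _ => Q o) fun S => hX r _ _)
      (summable_sub hsQ hsgain) fun φ hφ hp => ?_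
    obtain ⟨hφψ, hφe⟩ := (mem_consistent_update ho).1 hφ
    change (Q o).expect φ _ ≤ _
    rw [hφe, ← (Q o).expect_const φ (f (ψ.dom ∪ {e}) φ - f ψ.dom φ - _), ← Policy.expect_sub]
    refine (Q o).expect_mono φ fun S _ => ?_
    -- The run ends at an extension of ψ, so the current `topMarginal` dominates the final one that
    -- the target charges.
    have hanti : topMarginal p f B d (restrict φ (ψ.dom ∪ insert e S)) ≤
        topMarginal p f B d ψ := by
      refine topMarginal_anti hsub hmono hs B d ?_ (prob_pos (mem_consistent_restrict φ _) hp)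
      nth_rw 1 [← restrict_dom hφψ]
      exact restrict_isSub_restrict φ Finset.subset_union_left
    have hmul := mul_le_mul_of_nonneg_left hanti hβ
    simp only [X, dom_update, Finset.union_singleton, Finset.insert_union, Finset.union_insert]
      at hmul ⊢
    push_cast
    linarith

/-- Blockwise greedy gains at least `1 - ε` times the sum over the blocks of the largest sums of
marginal utilities that are left at the end. -/
theorem blockwiseGreedy_gain (hsub : FullyAdaptiveSubmodular p f) (hmono : AdaptiveMonotone p f)
    (hs : ∀ S, Summable fun φ => (p φ).toReal * f S φ) (rule : ArgmaxRule E O) {ε : ℝ}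
    (h0 : 0 < ε) (h1 : ε < 1) (L : List (Finset E × ℕ)) (hL : ∀ x ∈ L, x.2 ≤ x.1.card) :
    (∀ S, Summable fun φ => (p φ).toReal *
      ((1 - ε) * (L.map fun x => topMarginal p f x.1 x.2 (restrict φ S)).sum)) ∧
    ∀ ψ : PartialRealization E O, 0 ≤ consSum p ψ fun φ =>
      ((blockwiseGreedy rule ε L ψ).toPolicy fun e ψ => marginal p f {e} ψ).expect φ
        fun S => f (ψ.dom ∪ S) φ - f ψ.dom φ - (1 - ε) *
          (L.map fun x => topMarginal p f x.1 x.2 (restrict φ (ψ.dom ∪ S))).sum := by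
  induction L with
  | nil =>
    refine ⟨fun S => by simp, fun ψ => ?_⟩
    simp [blockwiseGreedy, Algorithm.toPolicy, Policy.expect_halt, consSum_const]
  | cons x L ih =>
    obtain ⟨ihs, ih⟩ := ih fun x hx => hL x (List.mem_cons_of_mem _ hx)
    obtain ⟨B, d⟩ := x
    have hB : d ≤ B.card := hL (B, d) List.mem_cons_self
    simp_rw [List.map_cons, List.sum_cons, mul_add]
    refine ⟨fun S => (summable_const_mul _
      (summable_topMarginal hsub hmono hs B d S)).add (ihs S), fun ψ => ?_⟩
    -- With `d = 0` there are no rounds, the block's `topMarginal` is zero, and the rate (1 - ε) / d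
    -- is meaningless.
    rcases Nat.eq_zero_or_pos d with rfl | hd
    · have hzero (ψ : PartialRealization E O) : topMarginal p f B 0 ψ = 0 := by
        obtain ⟨T, _, hT, h⟩ := exists_topSum_eq B 0 fun e => marginal p f {e} ψ
        rw [Nat.le_zero, Finset.card_eq_zero] at hT
        rw [topMarginal, h, hT, Finset.sum_empty]
      simp only [hzero, mul_zero, zero_add]
      exact ih ψ
    · have h := stochasticGreedy_gain hsub hmono hs rule h0 h1 hd hB
        (next := blockwiseGreedy rule ε L)
        (R := fun ψ => (1 - ε) * (L.map fun x => topMarginal p f x.1 x.2 ψ).sum) ihs ih d ψ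
      have hd' : (d : ℝ) ≠ 0 := by exact_mod_cast hd.ne'
      rw [mul_div_cancel₀ _ hd'] at h
      simp_rw [add_comm ((1 - ε) * topMarginal p f B d _)]
      exact h

/-- Generalized stochastic greedy is a `(1 - ε) / (2 - ε)`-approximation. -/
theorem favg_gasgPolicy_ge (hf : ∀ S φ, 0 ≤ f S φ) (hsub : FullyAdaptiveSubmodular p f)
    (hmono : AdaptiveMonotone p f) (hs : ∀ S, Summable fun φ => (p φ).toReal * f S φ)
    (rule : ArgmaxRule E O) {ε : ℝ} (h0 : 0 < ε) (h1 : ε < 1) {b : ℕ} {B : Fin b → Finset E}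
    {d : Fin b → ℕ} (hB : ∀ i j, i ≠ j → Disjoint (B i) (B j)) (hcover : ∀ e, ∃ i, e ∈ B i)
    (hd : ∀ i, d i ≤ (B i).card) {π : Policy E O} (hπ : π ∈ feasiblePolicies O B d) :
    (1 - ε) * favg p f π ≤ (2 - ε) * favg p f (gasgPolicy p f rule ε B d) := by
  set G := gasgPolicy p f rule ε B d with hG
  obtain ⟨hsL, hgain⟩ := blockwiseGreedy_gain hsub hmono hs rule h0 h1
    (List.ofFn fun i => (B i, d i)) (by
      intro x hx
      obtain ⟨i, rfl⟩ := (List.mem_ofFn' _ _).1 hx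
      exact hd i)
  let T : Finset E → (E → O) → ℝ := fun S φ => ∑ i, topMarginal p f (B i) (d i) (restrict φ S)
  have hsT (S : Finset E) : Summable fun φ => (p φ).toReal * T S φ := by
    simp only [T, Finset.mul_sum]
    exact summable_sum fun i _ => summable_topMarginal hsub hmono hs (B i) (d i) S
  have hgain' : (1 - ε) * (consSum p (fun _ => none) fun φ => G.expect φ fun S => T S φ) ≤
      favg p f G - consSum p (fun _ => none) fun φ => f ∅ φ := by
    rw [← sub_nonneg, favg, ← consSum_empty, ← consSum_const_mul,
      ← consSum_sub (summable_expect (fun _ => G) hs) (hs _),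
      ← consSum_sub (summable_sub (summable_expect (fun _ => G) hs) (hs _))
        (summable_const_mul _ (summable_expect (fun _ => G) hsT))]
    refine (hgain fun _ => none).trans_eq (consSum_congr fun φ _ => ?_)
    simp only [dom_empty, Finset.empty_union, List.map_ofFn, List.sum_ofFn, Function.comp_apply]
    rw [Policy.expect_sub, Policy.expect_sub, Policy.expect_const, Policy.expect_mul_left]
    rfl
  -- `H` is the gain of `π` on top of the items of greedy, and `T` is the bound on its conditional
  -- mean.
  let H : Finset E → (E → O) → ℝ := fun S φ => π.expect φ fun S' => f (S ∪ S') φ - f S φ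
  have hsH (S : Finset E) : Summable fun φ => (p φ).toReal * H S φ :=
    summable_expect (fun _ => π) (K := fun S' φ => f (S ∪ S') φ - f S φ)
      fun S' => summable_sub (hs _) (hs _)
  have hopt : (consSum p (fun _ => none) fun φ => G.expect φ fun S => H S φ) ≤
      consSum p (fun _ => none) fun φ => G.expect φ fun S => T S φ := by
    rw [← sub_nonneg, ← consSum_sub (summable_expect (fun _ => G) hsT)
      (summable_expect (fun _ => G) hsH)]
    have h := consSum_expect_nonneg (K := fun S φ => T S φ - H S φ)
      (fun S => summable_sub (hsT S) (hsH S)) (fun ψ => ?_) G fun _ => none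
    · refine h.trans_eq (consSum_congr fun φ _ => ?_)
      simp only [dom_empty, Finset.empty_union]
      rw [Policy.expect_sub]
    · rw [consSum_sub (hsT _) (hsH _), sub_nonneg]
      refine (consSum_expect_le_sum_topMarginal hsub hmono hs hB hcover hπ ψ).trans_eq
        (consSum_congr fun φ hφ => ?_)
      simp only [T, restrict_dom hφ]
  have hunion : favg p f π - favg p f G ≤
      consSum p (fun _ => none) fun φ => G.expect φ fun S => H S φ := by
    have h := favg_le_tsum_union hmono hs G π
    refine (sub_le_sub_right h _).trans_eq ?_
    rw [favg, ← consSum_empty, ← consSum_empty, ← consSum_sub (summable_expect (fun _ => G)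
      (K := fun S φ => π.expect φ fun T => f (S ∪ T) φ)
      fun S => summable_expect (fun _ => π) fun T => hs _) (summable_expect (fun _ => G) hs)]
    refine consSum_congr fun φ _ => ?_
    simp only [H]
    simp_rw [Policy.expect_sub, Policy.expect_const]
  have hempty : 0 ≤ consSum p (fun _ => none) fun φ => f ∅ φ := by
    rw [consSum_empty]
    exact tsum_nonneg fun φ => mul_nonneg ENNReal.toReal_nonneg (hf _ _)
  -- Multiply f_avg(π) - f_avg(greedy) ≤ 𝔼[T] by 1 - ε and insert the gain of greedy; the utility of
  -- the empty set is dropped by `hempty`.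
  have h2 := mul_le_mul_of_nonneg_left (hunion.trans hopt) (show 0 ≤ 1 - ε by linarith)
  linarith

theorem favg_nonneg (hf : ∀ S φ, 0 ≤ f S φ) (π : Policy E O) :
    0 ≤ favg p f π :=
  tsum_nonneg fun _ => mul_nonneg ENNReal.toReal_nonneg
    (Finset.sum_nonneg fun _ _ => mul_nonneg ENNReal.toReal_nonneg (hf _ _))

/-- With x = 1 - 1/e - ε and y = 1 - ε, the two sides are x / (2(1 + x)) and y / (1 + y), where -1 <
x < y and y > 0. The claimed ratio may be negative. -/
theorem approximation_ratio_le {ε : ℝ} (h0 : 0 < ε) (h1 : ε < 1) :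
    (1 - 1 / Real.exp 1 - ε) / (4 - 2 / Real.exp 1 - 2 * ε) ≤ (1 - ε) / (2 - ε) := by
  have he : 0 < 1 / Real.exp 1 := one_div_pos.2 (Real.exp_pos 1)
  have he1 : 1 / Real.exp 1 < 1 := by
    rw [div_lt_one (Real.exp_pos 1)]
    exact Real.one_lt_exp_iff.2 one_pos
  have heq : 2 / Real.exp 1 = 2 * (1 / Real.exp 1) := by ring
  rw [heq]
  generalize 1 / Real.exp 1 = t at he he1
  rw [div_le_div_iff₀ (by linarith) (by linarith)]
  nlinarith [mul_pos (sub_pos.2 h1) (sub_pos.2 he1), mul_pos (sub_pos.2 h1) (sub_pos.2 h1)]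

end GreedyAnalysis
end AdaptiveSubmodular

/-- The constant `C` in the query bound depends only on the upper bound `ε₀ < 1` for `ε`. -/
theorem mainTheorem6 (ε₀ : ℝ) (hε₀ : ε₀ < 1) :
    ∃ C : ℝ, ∀ (E : Type u) [Fintype E] [DecidableEq E] (O : Type v)
      (p : PMF (E → O)) (f : Finset E → (E → O) → ℝ),
      (∀ S φ, 0 ≤ f S φ) →
      (∀ S, Summable fun φ => (p φ).toReal * f S φ) →
      AdaptiveSubmodular.FullyAdaptiveSubmodular p f →
      AdaptiveSubmodular.AdaptiveMonotone p f →
      ∀ (b : ℕ) (B : Fin b → Finset E) (d : Fin b → ℕ),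
        (∀ i j, i ≠ j → Disjoint (B i) (B j)) →
        (∀ e, ∃ i, e ∈ B i) →
        (∀ i, d i ≤ (B i).card) →
        ∀ ε : ℝ, 0 < ε → ε ≤ ε₀ →
        ∀ rule : AdaptiveSubmodular.ArgmaxRule E O,
          AdaptiveSubmodular.gasgPolicy p f rule ε B d ∈
              AdaptiveSubmodular.feasiblePolicies O B d ∧
          (∀ πopt ∈ AdaptiveSubmodular.feasiblePolicies O B d,
            AdaptiveSubmodular.favg p f (AdaptiveSubmodular.gasgPolicy p f rule ε B d) ≥
              (1 - 1 / Real.exp 1 - ε) / (4 - 2 / Real.exp 1 - 2 * ε) *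
                AdaptiveSubmodular.favg p f πopt) ∧
          ((AdaptiveSubmodular.generalizedStochasticGreedy rule ε B d).queryCount : ENNReal) ≤
            ENNReal.ofReal (C * (Fintype.card E : ℝ) * Real.log (1 / ε)) := by
  refine ⟨1 + 1 / Real.log (1 / ε₀), ?_⟩
  intro E _ _ O p f hf hs hsub hmono b B d hB hcover hd ε h0 hε rule
  have h1 : ε < 1 := hε.trans_lt hε₀
  refine ⟨AdaptiveSubmodular.gasgPolicy_mem_feasiblePolicies p f rule ε d hB, fun πopt hopt => ?_,
    AdaptiveSubmodular.queryCount_generalizedStochasticGreedy_le hε₀ h0 hε rule hB hd⟩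
  have h := AdaptiveSubmodular.favg_gasgPolicy_ge hf hsub hmono hs rule h0 h1 hB hcover hd hopt
  refine (mul_le_mul_of_nonneg_right (AdaptiveSubmodular.approximation_ratio_le h0 h1)
    (AdaptiveSubmodular.favg_nonneg hf πopt)).trans ?_
  rw [div_mul_eq_mul_div, div_le_iff₀ (by linarith), mul_comm _ (2 - ε)]
  exact h
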